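/- Let $G$ be a finite group. For a prime $p$, $G$ is $p$-solvable if it has a series of normal subgroups $1=N_0\le N_1\le\dots\le N_n=G$ each of whose factors is a $p$-group or a group of order prime to $p$. If $M$ is a maximal subgroup of $G$ and $G$ is $p$-solvable for some prime $p$ dividing $|G:M|$, then $G/\mathrm{Core}_G(M)$ has a unique minimal normal subgroup, denoted $X_M$; it is an elementary abelian $p$-group, regarded as a $G$-module via conjugation. For an abelian group $X$ on which $G$ acts, $X^*=\mathrm{Hom}(X,\mathbb C^\times)$ denotes the dual module, with $G$-action $\lambda^g(x^g)=\lambda(x)$. A subgroup $U\subseteq G$ is a *regular intersection* if $G$ is $p$-solvable for every prime $p$ dividing $|G:U|$, and there is a (finite, possibly empty) family of maximal subgroups $M_i$ of $G$ such that $U=\bigcap_i M_i$ (the empty intersection being $G$) and, for all $i\neq j$, $X_{M_i}$ is isomorphic as a $G$-module neither to $X_{M_j}$ nor to $X_{M_j}^*$. **Theorem E.** Let $G$ be a finite group, let $\chi\in\mathrm{Irr}(G)$ be an irreducible complex character, and suppose that $\bar\chi\chi=(1_U)^G$ for a subgroup $U\subseteq G$, where $(1_U)^G$ is the character of $G$ induced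 from the trivial character of $U$. If $U$ is a regular intersection, then $\chi$ is quasi-primitive, i.e. for every normal subgroup $N$ of $G$ the restriction $\chi|_N$ is a multiple of an irreducible character of $N$. -/

import Mathlib

namespace WildeChar

/-! ### Complex characters of finite groups -/

section Characters

variable {G : Type*} [Group G]

/-- `χ` is the character of an irreducible complex representation of `G` of finite degree
(up to isomorphism such a representation acts on some `ℂⁿ`). -/
def IsIrr (χ : G → ℂ) : Prop :=
  ∃ (n : ℕ) (ρ : Representation ℂ G (Fin n → ℂ)), ρ.IsIrreducible ∧ ρ.character = χ

/-- `χ` is an irreducible character of `G` whose restriction to every normal subgroup `N` is a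
multiple of an irreducible character of `N`. -/
def IsQuasiPrimitive (χ : G → ℂ) : Prop :=
  IsIrr χ ∧ ∀ N : Subgroup G, N.Normal →
    ∃ (θ : N → ℂ) (e : ℕ), IsIrr θ ∧ ∀ x : N, χ x = e * θ x

open Classical in
/-- The induced function `θ^G` of a function `θ` on the subgroup `U`:
`θ^G(g) = |U|⁻¹ ∑_{x ∈ G} θ°(x⁻¹ g x)`, where `θ°` is `θ` on `U` and `0` off `U`. -/
noncomputable def induced [Fintype G] (U : Subgroup G) (θ : U → ℂ) (g : G) : ℂ :=
  (Nat.card U : ℂ)⁻¹ * ∑ x : G, if h : x⁻¹ * g * x ∈ U then θ ⟨x⁻¹ * g * x, h⟩ else 0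

end Characters

/-! ### `p`-solvable groups -/

/-- `G` is `p`-solvable: it has a series of normal subgroups `1 = N₀ ≤ N₁ ≤ ⋯ ≤ Nₙ = G` each
factor of which is either a `p`-group or a `p'`-group. (For finite groups `G` and primes `p`.) -/
def IsPSolvable (p : ℕ) (G : Type*) [Group G] : Prop :=
  ∃ (n : ℕ) (N : ℕ → Subgroup G), N 0 = ⊥ ∧ N n = ⊤ ∧ (∀ i, (N i).Normal) ∧
    ∀ i < n, N i ≤ N (i + 1) ∧
      ((∃ k : ℕ, (N i).relIndex (N (i + 1)) = p ^ k) ∨ ¬ p ∣ (N i).relIndex (N (i + 1)))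

/-! ### The module `X_M` of a maximal subgroup `M` -/

/-- `N` is a minimal normal subgroup of `H`: minimal among the nontrivial normal subgroups. -/
def IsMinimalNormal {H : Type*} [Group H] (N : Subgroup H) : Prop :=
  N.Normal ∧ N ≠ ⊥ ∧ ∀ K : Subgroup H, K.Normal → K ≠ ⊥ → K ≤ N → K = N

section XM

variable {G : Type*} [Group G]

/-- The subgroup `X_M` of `G / Core_G(M)`: the subgroup generated by the minimal normal subgroups
of `G / Core_G(M)`. It is *the* minimal normal subgroup of `G / Core_G(M)` whenever that is unique
(see `XM_eq_of_unique`), and it is only used in that case. -/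
def XM (M : Subgroup G) : Subgroup (G ⧸ M.normalCore) :=
  sSup {N | IsMinimalNormal N}

theorem XM_eq_of_unique (M : Subgroup G) (N : Subgroup (G ⧸ M.normalCore))
    (hN : IsMinimalNormal N) (huniq : ∀ K, IsMinimalNormal K → K = N) : XM M = N :=
  le_antisymm (sSup_le fun K hK => (huniq K hK).le) (le_sSup hN)

instance XM_normal (M : Subgroup G) : (XM M).Normal := by
  rw [XM, sSup_eq_iSup, Subgroup.normal_iff_map_conj_eq]
  intro g
  simp only [Subgroup.map_iSup]
  exact iSup_congr fun N => iSup_congr fun hN => Subgroup.normal_iff_map_conj_eq.mp hN.1 g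

/-- The action of `G` on `X_M` by conjugation. -/
def conjAction (M : Subgroup G) : G →* MulAut (XM M) :=
  (MulAut.conjNormal (H := XM M)).comp (QuotientGroup.mk' M.normalCore)

/-- The action of `G` on the dual `X^* = Hom(X, ℂˣ)` of an (abelian) group `X` on which `G` acts,
determined by `(g • l) (g • x) = l x`. -/
def dualAction {X : Type*} [Group X] (a : G →* MulAut X) : G →* MulAut (X →* ℂˣ) where
  toFun g :=
    { toFun := fun l => l.comp (a g⁻¹).toMonoidHom
      invFun := fun l => l.comp (a g).toMonoidHom
      left_inv := fun l => by ext x; simp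
      right_inv := fun l => by ext x; simp
      map_mul' := fun l m => by ext x; simp }
  map_one' := by ext l x; simp
  map_mul' g h := by ext l x; simp

theorem dualAction_apply {X : Type*} [Group X] (a : G →* MulAut X) (g : G) (l : X →* ℂˣ) (x : X) :
    dualAction a g l (a g x) = l x := by
  simp [dualAction]

/-- Two groups with an action of `G` by automorphisms are isomorphic as `G`-groups
(as `G`-modules, if they are abelian). -/
def GIso {X Y : Type*} [Mul X] [Mul Y] (a : G →* MulAut X) (b : G →* MulAut Y) : Prop :=
  ∃ f : X ≃* Y, ∀ (g : G) (x : X), f (a g x) = b g (f x)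

/-- `U` is a regular intersection in the finite group `G`. -/
def IsRegularIntersection (U : Subgroup G) : Prop :=
  (∀ p : ℕ, p.Prime → p ∣ U.index → IsPSolvable p G) ∧
  ∃ (n : ℕ) (M : Fin n → Subgroup G),
    (∀ i, IsCoatom (M i)) ∧ U = ⨅ i, M i ∧
    ∀ i j, i ≠ j →
      ¬ GIso (conjAction (M i)) (conjAction (M j)) ∧
      ¬ GIso (conjAction (M i)) (dualAction (conjAction (M j)))

end XM

end WildeChar

/-! Let $\rho$ afford $\chi$. The hypothesis says that $\chi$ vanishes off the conjugates of $U$ and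
nowhere on $U$, and for normal $N$ it gives $[\chi_N,\chi_N]=|G:UN|$ (`card_mul_finrank_commutant`).
Homogeneity of $\chi_N$ is proved by induction on $|N|$, through a chief factor $N/S$ with $S$
already homogeneous.

By non-isomorphism of the modules, at most one $M_i$ contains $S$ but not $N$. If there is none,
then $UN=US$ (`iInf_sup_eq`), so $\rho(N)$ and $\rho(S)$ have the same commutant and homogeneity
passes from $S$ to $N$. If there is one, $N/S$ is an elementary abelian $p$-group isomorphic to
$X_{M_i}$, and $N\cap M_i=S$ forces $\chi=0$ on $N\setminus S$.

In the second case, Skolem–Noether corrects each $\rho(r)$ by an element of the span of $\rho(S)$ to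
a unit centralizing $\rho(S)$, a lift of $r$, unique up to scalars. Conjugating lifts of elements of
$N$ by the centralizer $C$ of $N/S$ gives a pairing $C\times N/S\to\mathbb C^\times$. Its radical in
$N$ is normal, so it is $S$ or $N$. Radical $S$ makes $N$ homogeneous
(`IsVanishing.homogeneous_of_nondegenerate`).

Radical $N$ is impossible. Let $K\le C$ be the left kernel of the pairing; then $N\le K$. If $K<C$,
then $C/K$ is a chief factor dual to $N/S$ (`IsVanishing.dual_chief`) and $\chi=0$ on $C\setminus
K$. An $M_j$ containing $K$ but not $C$ would have $X_{M_j}\cong X_{M_i}^*$ with $j\ne i$; without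
such $M_j$, $UC=UK$ and some element of $U$ lies in $C\setminus K$, where $\chi$ vanishes. If $K=C$,
coprime action splits the scalars off the abelian group of lifts, and Schur's lemma kills the
complement (`IsVanishing.false_of_centralizing`). -/

namespace WildeChar

open Module Representation

/-! ### Spans, commutants and homogeneous restrictions -/

section RepresentationTheory

variable {G V : Type*} [Group G] [AddCommGroup V] [Module ℂ V]

/-- The subalgebra of `End V` spanned by the image of a subgroup `N`. -/
noncomputable def spanAlg (ρ : Representation ℂ G V) (N : Subgroup G) :
    Subalgebra ℂ (Module.End ℂ V) :=
  (asAlgebraHom (ρ.comp N.subtype)).range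

/-- The subalgebra of `End V` of the endomorphisms commuting with a subgroup `N`. -/
def commutant (ρ : Representation ℂ G V) (N : Subgroup G) : Subalgebra ℂ (Module.End ℂ V) :=
  Subalgebra.centralizer ℂ (ρ '' N)

/-- The restriction of `ρ` to `N` is homogeneous, in the sense that the center of the algebra
spanned by the image of `N` consists of scalars. -/
def IsHomogeneous (ρ : Representation ℂ G V) (N : Subgroup G) : Prop :=
  ∀ z ∈ spanAlg ρ N, z ∈ commutant ρ N → ∃ c : ℂ, z = c • 1

variable {ρ : Representation ℂ G V} {N : Subgroup G}

theorem mem_commutant {z : Module.End ℂ V} :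
    z ∈ commutant ρ N ↔ ∀ n ∈ N, ρ n * z = z * ρ n := by
  simp [commutant, Subalgebra.mem_centralizer_iff]

theorem apply_mem_spanAlg {n : G} (hn : n ∈ N) : ρ n ∈ spanAlg ρ N :=
  ⟨MonoidAlgebra.single ⟨n, hn⟩ 1, by simp⟩

@[elab_as_elim]
theorem spanAlg_induction {p : (z : Module.End ℂ V) → z ∈ spanAlg ρ N → Prop}
    (hsmul : ∀ n (hn : n ∈ N) (c : ℂ),
      p (c • ρ n) (Subalgebra.smul_mem _ (apply_mem_spanAlg hn) c))
    (hadd : ∀ a b ha hb, p a ha → p b hb → p (a + b) (add_mem ha hb))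
    {z : Module.End ℂ V} (hz : z ∈ spanAlg ρ N) : p z hz := by
  have key : ∃ hz : z ∈ spanAlg ρ N, p z hz := by
    obtain ⟨x, rfl⟩ := hz
    induction x using MonoidAlgebra.induction_linear with
    | zero => exact ⟨by simp, by simpa using hsmul 1 N.one_mem 0⟩
    | add f g hf hg =>
      obtain ⟨hf', hf⟩ := hf
      obtain ⟨hg', hg⟩ := hg
      simp only [AlgHom.toRingHom_eq_coe, RingHom.coe_coe, map_add] at hf hg hf' hg' ⊢
      exact ⟨add_mem hf' hg', hadd _ _ hf' hg' hf hg⟩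
    | single n c => exact ⟨by simpa using Subalgebra.smul_mem _ (apply_mem_spanAlg n.2) c,
        by simpa using hsmul n n.2 c⟩
  exact key.2

theorem commute_of_mem_spanAlg {a z : Module.End ℂ V} (ha : a ∈ spanAlg ρ N)
    (hz : z ∈ commutant ρ N) : a * z = z * a := by
  induction ha using spanAlg_induction with
  | hsmul n hn c => simp [mem_commutant.1 hz n hn]
  | hadd a b _ _ ha hb => simp [add_mul, mul_add, ha, hb]

theorem conj_mem_spanAlg (hN : N.Normal) (g : G) {a : Module.End ℂ V} (ha : a ∈ spanAlg ρ N) :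
    ρ g * a * ρ g⁻¹ ∈ spanAlg ρ N := by
  induction ha using spanAlg_induction with
  | hsmul n hn c =>
    simp only [mul_smul_comm, smul_mul_assoc, ← map_mul]
    exact Subalgebra.smul_mem _ (apply_mem_spanAlg (hN.conj_mem n hn g)) c
  | hadd a b _ _ ha hb => simpa [add_mul, mul_add] using add_mem ha hb

theorem conj_mem_commutant (hN : N.Normal) (g : G) {z : Module.End ℂ V}
    (hz : z ∈ commutant ρ N) : ρ g * z * ρ g⁻¹ ∈ commutant ρ N := by
  rw [mem_commutant] at hz ⊢
  intro n hn
  have h := hz (g⁻¹ * n * g) (by simpa using hN.conj_mem n hn g⁻¹)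
  have e1 : ρ n = ρ g * ρ (g⁻¹ * n * g) * ρ g⁻¹ := by simp only [← map_mul]; congr 1; group
  have e2 : ρ g⁻¹ * ρ g = 1 := by simp only [← map_mul, inv_mul_cancel, map_one]
  calc ρ n * (ρ g * z * ρ g⁻¹) = ρ g * ρ (g⁻¹ * n * g) * (ρ g⁻¹ * ρ g) * z * ρ g⁻¹ := by
        rw [e1]; simp only [mul_assoc]
    _ = ρ g * z * (ρ g⁻¹ * ρ g) * ρ (g⁻¹ * n * g) * ρ g⁻¹ := by
        rw [e2]; rw [mul_one, mul_one, mul_assoc (ρ g), h, mul_assoc (ρ g) z, mul_assoc (ρ g)]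
    _ = _ := by rw [e1]; simp only [mul_assoc]

theorem commutant_anti {N N' : Subgroup G} (h : N ≤ N') : commutant ρ N' ≤ commutant ρ N :=
  fun _ hz => mem_commutant.2 fun n hn => mem_commutant.1 hz n (h hn)

variable [FiniteDimensional ℂ V]

open scoped ComplexConjugate ComplexOrder in
-- Averaging produces an invariant positive definite form `P`, so the matrix of `g⁻¹` is similar to
-- the conjugate transpose of that of `g`.
theorem character_inv [Finite G] (ρ : Representation ℂ G V) (g : G) :
    ρ.character g⁻¹ = conj (ρ.character g) := by
  classical
  have := Fintype.ofFinite G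
  let b := Module.finBasis ℂ V
  let M : G → Matrix (Fin (finrank ℂ V)) (Fin (finrank ℂ V)) ℂ := fun g => LinearMap.toMatrix b b (ρ g)
  have hM : ∀ g h, M (g * h) = M g * M h := fun g h => by
    simp only [M, map_mul]; exact LinearMap.toMatrix_mul b _ _
  have hM1 : M 1 = 1 := by simp [M]
  have htr : ∀ g, ρ.character g = (M g).trace := fun g => LinearMap.trace_eq_matrix_trace ℂ b _
  let P := ∑ h, (M h).conjTranspose * M h
  have hPu : IsUnit P := by
    have hsum : P = (M 1).conjTranspose * M 1 + ∑ h ∈ Finset.univ.erase 1,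
      (M h).conjTranspose * M h := (Finset.add_sum_erase _ _ (Finset.mem_univ _)).symm
    rw [hsum, hM1, Matrix.conjTranspose_one, one_mul]
    refine Matrix.PosDef.isUnit <| Matrix.PosDef.one.add_posSemidef
      (Matrix.posSemidef_sum _ fun h _ => Matrix.posSemidef_conjTranspose_mul_self _)
  have hinv : (M g).conjTranspose * P * M g = P := by
    simp only [P, Finset.mul_sum, Finset.sum_mul]
    conv_rhs => rw [← Equiv.sum_comp (Equiv.mulRight g)]
    refine Finset.sum_congr rfl fun h _ => ?_
    simp [hM, Matrix.conjTranspose_mul, mul_assoc]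
  have hgg : M g * M g⁻¹ = 1 := by rw [← hM, mul_inv_cancel, hM1]
  have h1 : P * M g⁻¹ = (M g).conjTranspose * P := by
    calc P * M g⁻¹ = (M g).conjTranspose * P * (M g * M g⁻¹) := by
          rw [← mul_assoc, hinv]
      _ = _ := by rw [hgg, mul_one]
  obtain ⟨u, hu⟩ := hPu
  have h2 : M g⁻¹ = (↑u⁻¹ : Matrix _ _ ℂ) * ((M g).conjTranspose * (u : Matrix _ _ ℂ)) := by
    rw [hu, ← h1, ← hu, Units.inv_mul_cancel_left]
  rw [htr, htr, h2, Matrix.trace_mul_comm, mul_assoc, Units.mul_inv, mul_one,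
    Matrix.trace_conjTranspose]
  rfl

theorem finrank_commutant [Finite G] [Fintype N] (ρ : Representation ℂ G V) :
    (finrank ℂ (commutant ρ N) : ℂ) =
      (Nat.card N : ℂ)⁻¹ * ∑ n : N, ρ.character n * ρ.character (n : G)⁻¹ := by
  have : Invertible (Nat.card N : ℂ) := invertibleOfNonzero (by simp)
  let σ : Representation ℂ N V := ρ.comp N.subtype
  have h := card_inv_mul_sum_char_mul_char_eq_finrank σ σ
  rw [← (invariantsEquivIntertwiningMap σ σ).finrank_eq] at h
  have he : Subalgebra.toSubmodule (commutant ρ N) = (linHom σ σ).invariants := by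
    ext z
    rw [Subalgebra.mem_toSubmodule, mem_commutant, mem_invariants]
    simp only [linHom_apply]
    rw [mem_linHom_invariants_iff_isIntertwining]
    constructor
    · exact fun h => ⟨fun n v => (LinearMap.congr_fun (h n n.2) v).symm⟩
    · exact fun h n hn => LinearMap.ext fun v => (h.isIntertwining ⟨n, hn⟩ v).symm
  have : finrank ℂ (commutant ρ N) = finrank ℂ (linHom σ σ).invariants := by
    rw [← he]; rfl
  rw [this, ← h]
  rfl

/-- Double centralizer theorem: by Maschke `V` is semisimple, and Jacobson density on a basis
realizes `z` by an element of the group algebra. -/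
theorem mem_spanAlg_of_commute [Finite G] (z : Module.End ℂ V)
    (hz : ∀ c ∈ commutant ρ N, z * c = c * z) : z ∈ spanAlg ρ N := by
  classical
  let σ : Representation ℂ N V := ρ.comp N.subtype
  let _ : Module (MonoidAlgebra ℂ N) V := Module.compHom V (asAlgebraHom σ).toRingHom
  have hsmul : ∀ (a : MonoidAlgebra ℂ N) (v : V), a • v = asAlgebraHom σ a v := fun _ _ => rfl
  have hN0 : NeZero (Nat.card N : ℂ) := ⟨by simp [Nat.card_pos.ne']⟩
  have : IsScalarTower ℂ (MonoidAlgebra ℂ N) V := ⟨fun c a v => by simp [hsmul]⟩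
  have hss : IsSemisimpleModule (MonoidAlgebra ℂ N) V := inferInstance
  let f : Module.End (Module.End (MonoidAlgebra ℂ N) V) V :=
    { toFun := z
      map_add' := map_add z
      map_smul' := fun c v => by
        have hc : c.restrictScalars ℂ ∈ commutant ρ N := by
          rw [mem_commutant]
          intro n hn
          ext v
          have := (c.map_smul (MonoidAlgebra.single ⟨n, hn⟩ (1 : ℂ)) v).symm
          simpa [hsmul, σ] using this
        exact LinearMap.congr_fun (hz _ hc) v }
  let b := Module.finBasis ℂ V
  obtain ⟨r, hr⟩ := jacobson_density f (Finset.univ.image b)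
  refine ⟨r, b.ext fun i => ?_⟩
  exact (hr (b i) (Finset.mem_image_of_mem b (Finset.mem_univ i))).symm

variable [Nontrivial V]

/-- By Wedderburn–Artin the span is a product of matrix algebras, and a centre consisting of scalars
leaves room for only one factor. -/
theorem IsHomogeneous.exists_algEquiv [Finite G] (h : IsHomogeneous ρ N) :
    ∃ (n : ℕ) (_ : NeZero n), Nonempty (spanAlg ρ N ≃ₐ[ℂ] Matrix (Fin n) (Fin n) ℂ) := by
  classical
  have hN0 : NeZero (Nat.card N : ℂ) := ⟨by simp [Nat.card_pos.ne']⟩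
  have hss : IsSemisimpleRing (MonoidAlgebra ℂ N) := inferInstance
  have : IsSemisimpleRing (spanAlg ρ N) :=
    RingHom.isSemisimpleRing_of_surjective
      (asAlgebraHom (ρ.comp N.subtype)).rangeRestrict.toRingHom
      (AlgHom.rangeRestrict_surjective _)
  obtain ⟨m, d, hd, ⟨e⟩⟩ :=
    IsSemisimpleRing.exists_algEquiv_pi_matrix_of_isAlgClosed ℂ (spanAlg ρ N)
  have hm : ∀ i j : Fin m, i = j := by
    intro i j
    by_contra hij
    -- The identity of block `i` is central, hence scalar, but it is 0 in block `j` and 1 in block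
    -- `i`.
    let s : Π i, Matrix (Fin (d i)) (Fin (d i)) ℂ := Pi.single i 1
    have hs : ∀ x, x * s = s * x := by
      intro x
      ext1 k
      by_cases hk : k = i
      · subst hk; simp [s]
      · simp [s, hk]
    obtain ⟨c, hc⟩ := h (e.symm s) (e.symm s).2 (mem_commutant.2 fun n hn => by
      have := congrArg (fun x => ((e.symm x : spanAlg ρ N) : Module.End ℂ V))
        (hs (e ⟨ρ n, apply_mem_spanAlg hn⟩))
      simpa using this)
    have hc' : e.symm s = c • 1 := Subtype.ext hc
    have hs' : s = c • 1 := by rw [← e.apply_symm_apply s, hc']; simp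
    have h1 : c = 0 := by
      have := congrFun (congrFun (congrFun hs' j) 0) 0
      simpa [s, Pi.single_eq_of_ne (Ne.symm hij)] using this.symm
    have h2 := congrFun (congrFun (congrFun hs' i) 0) 0
    simp [s, h1] at h2
  have hm0 : Nonempty (Fin m) := by
    by_contra hne
    rw [not_nonempty_iff] at hne
    have : Subsingleton (spanAlg ρ N) := e.injective.subsingleton
    exact one_ne_zero (congrArg Subtype.val (Subsingleton.elim (1 : spanAlg ρ N) 0))
  obtain ⟨i⟩ := hm0
  refine ⟨d i, hd i, ⟨e.trans (AlgEquiv.ofBijective (Pi.evalAlgHom ℂ _ i) ⟨?_, ?_⟩)⟩⟩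
  · intro x y hxy
    ext1 j
    obtain rfl := hm i j
    exact hxy
  · exact Function.surjective_eval i

/-- The span is a full matrix algebra, whose natural module gives $\theta$. The trace of `V` is a
trace form on that algebra, hence a multiple of the matrix trace; the factor is the trace of a
primitive idempotent acting on `V`, that is, its rank. -/
theorem IsHomogeneous.exists_isIrr [Finite G] (h : IsHomogeneous ρ N) :
    ∃ (θ : N → ℂ) (e : ℕ), IsIrr θ ∧ ∀ x : N, ρ.character x = e * θ x := by
  obtain ⟨n, hn, ⟨ψ⟩⟩ := h.exists_algEquiv
  let φ : spanAlg ρ N ≃ₐ[ℂ] Module.End ℂ (Fin n → ℂ) := ψ.trans Matrix.toLinAlgEquiv'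
  let σ : Representation ℂ N (Fin n → ℂ) :=
    { toFun := fun x => φ ⟨ρ x, apply_mem_spanAlg x.2⟩
      map_one' := by
        rw [← map_one φ]; congr 1; ext1; simp
      map_mul' := fun x y => by
        rw [← map_mul φ]; congr 1; ext1; simp }
  have hσ : ∀ (W : Subrepresentation σ) (a : spanAlg ρ N), ∀ w ∈ W.toSubmodule,
      φ a w ∈ W.toSubmodule := by
    rintro W ⟨a, ha⟩ w hw
    induction ha using spanAlg_induction with
    | hsmul m hm c =>
      have : (⟨c • ρ m, Subalgebra.smul_mem _ (apply_mem_spanAlg hm) c⟩ : spanAlg ρ N) =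
        c • ⟨ρ m, apply_mem_spanAlg hm⟩ := rfl
      rw [this, map_smul]
      exact W.toSubmodule.smul_mem c (W.apply_mem_toSubmodule ⟨m, hm⟩ hw)
    | hadd a b ha hb iha ihb =>
      have : (⟨a + b, add_mem ha hb⟩ : spanAlg ρ N) = ⟨a, ha⟩ + ⟨b, hb⟩ := rfl
      rw [this, map_add]
      exact W.toSubmodule.add_mem iha ihb
  have hirr : σ.IsIrreducible :=
    { exists_pair_ne := by
        refine ⟨⊥, ⊤, fun h => ?_⟩
        have h1 : (⊥ : Submodule ℂ (Fin n → ℂ)) = ⊤ := congrArg Subrepresentation.toSubmodule h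
        exact bot_ne_top h1
      eq_bot_or_eq_top := fun W => by
        by_cases hW : W.toSubmodule = ⊥
        · exact Or.inl (Subrepresentation.toSubmodule_injective hW)
        · refine Or.inr (Subrepresentation.toSubmodule_injective ?_)
          obtain ⟨w, hw, hw0⟩ := Submodule.exists_mem_ne_zero_of_ne_bot hW
          obtain ⟨f, hf⟩ := Module.Projective.exists_dual_eq_one ℂ hw0
          -- The rank-one operator sending `w` to `v` belongs to the algebra, so every `v` lies in
          -- `W`.
          refine eq_top_iff.2 fun v _ => ?_
          have := hσ W (φ.symm (f.smulRight v)) w hw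
          simpa [hf] using this }
  let E : Fin n → Fin n → Matrix (Fin n) (Fin n) ℂ := fun i j => Matrix.single i j 1
  let τ : Matrix (Fin n) (Fin n) ℂ →ₗ[ℂ] ℂ :=
    (LinearMap.trace ℂ V).comp ((spanAlg ρ N).val.comp ψ.symm.toAlgHom).toLinearMap
  have hτ : ∀ A B, τ (A * B) = τ (B * A) := fun A B => by
    simp only [τ, LinearMap.comp_apply, AlgHom.toLinearMap_apply, map_mul]
    exact LinearMap.trace_mul_comm ℂ _ _
  have hτE : ∀ i j, τ (E i j) = if i = j then τ (E 0 0) else 0 := by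
    intro i j
    have h1 : E i j = E i 0 * E 0 j := by simp [E]
    have h2 : E 0 j * E i 0 = if i = j then E 0 0 else 0 := by
      split_ifs with hij
      · simp [E, hij]
      · simp only [E]; rw [Matrix.single_mul_single_of_ne _ _ _ _ (Ne.symm hij)]
    rw [h1, hτ, h2]
    split_ifs <;> simp
  have hτM : ∀ M, τ M = τ (E 0 0) * M.trace := by
    intro M
    conv_lhs => rw [Matrix.matrix_eq_sum_single M]
    have : ∀ i j, Matrix.single i j (M i j) = M i j • E i j := fun i j => by simp [E]
    rw [Matrix.trace, Finset.mul_sum, map_sum]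
    refine Finset.sum_congr rfl fun i _ => ?_
    rw [map_sum, Finset.sum_eq_single i]
    · rw [this, map_smul, hτE, if_pos rfl, smul_eq_mul, mul_comm, Matrix.diag_apply]
    · intro j _ hij
      rw [this, map_smul, hτE, if_neg (Ne.symm hij), smul_zero]
    · simp
  let ε : Module.End ℂ V := (ψ.symm (E 0 0) : spanAlg ρ N)
  have hε : IsIdempotentElem ε := by
    have : ψ.symm (E 0 0) * ψ.symm (E 0 0) = ψ.symm (E 0 0) := by
      rw [← map_mul]; simp [E]
    exact congrArg Subtype.val this
  have hτε : τ (E 0 0) = (finrank ℂ (LinearMap.range ε) : ℂ) :=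
    (LinearMap.IsIdempotentElem.isProj_range ε hε).trace
  refine ⟨σ.character, finrank ℂ (LinearMap.range ε), ⟨n, σ, hirr, rfl⟩, fun x => ?_⟩
  let a : spanAlg ρ N := ⟨ρ x, apply_mem_spanAlg x.2⟩
  have h1 : ρ.character x = τ (ψ a) := by
    simp [τ, character, a]
  have h2 : σ.character x = (ψ a).trace := by
    change LinearMap.trace ℂ _ (Matrix.toLin' (ψ a)) = _
    exact Matrix.trace_toLin'_eq _
  rw [h1, h2, hτM, hτε]

/-- Skolem–Noether: conjugation by `ρ g⁻¹` is an automorphism of a matrix algebra, so it is induced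
by some unit `a` of it, and `ρ g * a` then centralizes `N`. -/
theorem IsHomogeneous.exists_unit [Finite G] (h : IsHomogeneous ρ N) (hN : N.Normal) (g : G) :
    ∃ u : (Module.End ℂ V)ˣ, (u : Module.End ℂ V) ∈ commutant ρ N ∧ ρ g⁻¹ * u ∈ spanAlg ρ N := by
  obtain ⟨n, hn, ⟨ψ⟩⟩ := h.exists_algEquiv
  let φ : spanAlg ρ N ≃ₐ[ℂ] Module.End ℂ (Fin n → ℂ) := ψ.trans Matrix.toLinAlgEquiv'
  have hinv : ∀ g, ρ g⁻¹ * ρ g = 1 := fun g => by rw [← map_mul]; simp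
  have hinv' : ∀ g, ρ g * ρ g⁻¹ = 1 := fun g => by rw [← map_mul]; simp
  let c : spanAlg ρ N ≃ₐ[ℂ] spanAlg ρ N :=
    { toFun := fun a => ⟨ρ g⁻¹ * a * ρ g, by simpa using conj_mem_spanAlg hN g⁻¹ a.2⟩
      invFun := fun a => ⟨ρ g * a * ρ g⁻¹, conj_mem_spanAlg hN g a.2⟩
      left_inv := fun a => by
        ext1; simp only [← mul_assoc, hinv', one_mul]; rw [mul_assoc, hinv', mul_one]
      right_inv := fun a => by
        ext1; simp only [← mul_assoc, hinv, one_mul]; rw [mul_assoc, hinv, mul_one]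
      map_mul' := fun a b => by
        ext1
        simp only [Subalgebra.coe_mul, mul_assoc]
        rw [← mul_assoc (ρ g) (ρ g⁻¹), hinv', one_mul]
      map_add' := fun a b => by ext1; simp [mul_add, add_mul]
      commutes' := fun z => by
        ext1; simp [Algebra.algebraMap_eq_smul_one, hinv] }
  obtain ⟨T, hT⟩ := (φ.symm.trans (c.trans φ)).eq_linearEquivConjAlgEquiv
  let a : spanAlg ρ N := φ.symm T.toLinearMap
  let b : spanAlg ρ N := φ.symm T.symm.toLinearMap
  have hab : a * b = 1 := by
    rw [← map_mul, ← map_one φ.symm]; congr 1; exact LinearMap.ext T.apply_symm_apply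
  have hba : b * a = 1 := by
    rw [← map_mul, ← map_one φ.symm]; congr 1; exact LinearMap.ext T.symm_apply_apply
  have hc : ∀ y, c y = a * y * b := by
    intro y
    have h1 := DFunLike.congr_fun hT (φ y)
    apply φ.injective
    simp only [AlgEquiv.trans_apply, AlgEquiv.symm_apply_apply] at h1
    rw [h1, map_mul, map_mul]
    simp only [a, b, AlgEquiv.apply_symm_apply]
    rfl
  have hab' : (a : Module.End ℂ V) * b = 1 := congrArg Subtype.val hab
  have hba' : (b : Module.End ℂ V) * a = 1 := congrArg Subtype.val hba
  refine ⟨⟨ρ g * a, b * ρ g⁻¹, ?_, ?_⟩, ?_, ?_⟩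
  · rw [mul_assoc, ← mul_assoc (a : Module.End ℂ V), hab', one_mul, hinv']
  · rw [mul_assoc, ← mul_assoc (ρ g⁻¹), hinv, one_mul, hba']
  · rw [mem_commutant]
    intro m hm
    have h1 := congrArg Subtype.val (hc ⟨ρ m, apply_mem_spanAlg hm⟩)
    have h2 : ρ g⁻¹ * ρ m * ρ g = a * ρ m * b := h1
    calc ρ m * (ρ g * a) = ρ g * (ρ g⁻¹ * ρ m * ρ g) * a := by
          simp only [← mul_assoc, hinv', one_mul]
      _ = ρ g * a * ρ m * (b * a) := by rw [h2]; simp only [mul_assoc]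
      _ = ρ g * a * ρ m := by rw [hba', mul_one]
  · simp only [← mul_assoc, hinv, one_mul]
    exact a.2

end RepresentationTheory

/-! ### Chief factors, maximal subgroups and the modules $X_M$ -/

section ChiefFactors

variable {G : Type*} [Group G]

/-- `R / S` is a chief factor of `G`. -/
structure IsChief (S R : Subgroup G) : Prop where
  normal_left : S.Normal
  normal_right : R.Normal
  lt : S < R
  eq_or_eq : ∀ T : Subgroup G, T.Normal → S ≤ T → T ≤ R → T = S ∨ T = R

theorem exists_isChief_below [Finite G] {N : Subgroup G} (hN : N.Normal) (h : N ≠ ⊥) :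
    ∃ S, IsChief S N := by
  obtain ⟨S, hS⟩ := (Set.toFinite {S : Subgroup G | S.Normal ∧ S < N}).exists_maximal
    ⟨⊥, inferInstance, bot_lt_iff_ne_bot.2 h⟩
  refine ⟨S, hS.1.1, hN, hS.1.2, fun T hT h1 h2 => ?_⟩
  by_cases hTN : T = N
  · exact Or.inr hTN
  · exact Or.inl (le_antisymm (hS.2 ⟨hT, lt_of_le_of_ne h2 hTN⟩ h1) h1)

theorem exists_isChief_above [Finite G] {N : Subgroup G} (hN : N.Normal) (h : N ≠ ⊤) :
    ∃ R, IsChief N R := by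
  obtain ⟨R, hR⟩ := (Set.toFinite {R : Subgroup G | R.Normal ∧ N < R}).exists_minimal
    ⟨⊤, inferInstance, lt_top_iff_ne_top.2 h⟩
  refine ⟨R, hN, hR.1.1, hR.1.2, fun T hT h1 h2 => ?_⟩
  by_cases hTN : T = N
  · exact Or.inl hTN
  · exact Or.inr (le_antisymm h2 (hR.2 ⟨hT, lt_of_le_of_ne h1 (Ne.symm hTN)⟩ h2))

theorem relIndex_dvd_relIndex_of_normal {N K L : Subgroup G} [N.Normal] (h : K ≤ L) :
    N.relIndex K ∣ N.relIndex L := by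
  rw [← Subgroup.relIndex_sup_right (H := K), ← Subgroup.relIndex_sup_right (H := L)]
  exact ⟨_, (Subgroup.relIndex_mul_relIndex N (K ⊔ N) (L ⊔ N) le_sup_right
    (sup_le_sup_right h N)).symm⟩

theorem IsChief.relIndex_eq_pow_or [Finite G] {p : ℕ} (hp : p.Prime) (hG : IsPSolvable p G)
    {S R : Subgroup G} (h : IsChief S R) :
    (∃ k : ℕ, S.relIndex R = p ^ k) ∨ ¬ p ∣ S.relIndex R := by
  classical
  obtain ⟨n, N, h0, hn, hnorm, hstep⟩ := hG
  have := h.normal_left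
  have := h.normal_right
  -- At the first term of the series with `R ⊓ N i` not inside `S`, that intersection covers `R /
  -- S`, so `|R : S|` divides the order of one factor of the series.
  have hex : ∃ i, ¬ R ⊓ N i ≤ S := ⟨n, by rw [hn, inf_top_eq]; exact h.lt.not_ge⟩
  have hi := Nat.find_spec hex
  have hmin : ∀ j < Nat.find hex, R ⊓ N j ≤ S := fun j hj => not_not.1 (Nat.find_min hex hj)
  have hle : Nat.find hex ≤ n := Nat.find_min' hex (by rw [hn, inf_top_eq]; exact h.lt.not_ge)
  generalize Nat.find hex = i at hi hmin hle
  obtain _ | j := i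
  · simp [h0] at hi
  have := hnorm j
  have := hnorm (j + 1)
  have hj := hmin j (Nat.lt_succ_self j)
  have hR : (R ⊓ N (j + 1)) ⊔ S = R := by
    refine (h.eq_or_eq _ inferInstance le_sup_right
      (sup_le inf_le_left h.lt.le)).resolve_left fun he => hi ?_
    rw [← he]; exact le_sup_left
  have hdvd : S.relIndex R ∣ (N j).relIndex (N (j + 1)) := by
    rw [← hR, Subgroup.relIndex_sup_right]
    have h1 : S.relIndex (R ⊓ N (j + 1)) ∣ (R ⊓ N j).relIndex (R ⊓ N (j + 1)) :=
      Subgroup.relIndex_dvd_of_le_left _ hj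
    have h2 : (R ⊓ N j).relIndex (R ⊓ N (j + 1)) = (N j).relIndex (R ⊓ N (j + 1)) := by
      rw [← Subgroup.inf_relIndex_right, ← Subgroup.inf_relIndex_right (N j)]
      congr 1
      have := (hstep j (by omega)).1
      ext x
      simp only [Subgroup.mem_inf]
      tauto
    rw [h2] at h1
    exact h1.trans (relIndex_dvd_relIndex_of_normal inf_le_right)
  rcases (hstep j (by omega)).2 with ⟨k, hk⟩ | hk
  · rw [hk] at hdvd
    obtain ⟨m, -, hm⟩ := (Nat.dvd_prime_pow hp).1 hdvd
    exact Or.inl ⟨m, hm⟩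
  · exact Or.inr fun hd => hk (hd.trans hdvd)

/-- Half of Dedekind's modular law. -/
theorem le_sup_inf_of_normal {N M C : Subgroup G} [N.Normal] (hNC : N ≤ C) (h : N ⊔ M = ⊤) :
    C ≤ N ⊔ M ⊓ C := by
  intro c hc
  obtain ⟨n, hn, m, hm, rfl⟩ := Subgroup.mem_sup_of_normal_left.1 (h ▸ Subgroup.mem_top c)
  refine Subgroup.mul_mem_sup hn ⟨hm, ?_⟩
  simpa using C.mul_mem (C.inv_mem (hNC hn)) hc

/-- The centralizer in `G` of the section `R / S`. -/
def centMod (S R : Subgroup G) [S.Normal] : Subgroup G :=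
  (Subgroup.centralizer (R.map (QuotientGroup.mk' S) : Set (G ⧸ S))).comap (QuotientGroup.mk' S)

theorem mem_centMod {S R : Subgroup G} [S.Normal] {g : G} :
    g ∈ centMod S R ↔ ∀ r ∈ R, g * r * g⁻¹ * r⁻¹ ∈ S := by
  simp only [centMod, Subgroup.mem_comap, Subgroup.mem_centralizer_iff, Subgroup.coe_map,
    Set.forall_mem_image, SetLike.mem_coe, QuotientGroup.mk'_apply]
  refine forall₂_congr fun r _ => ?_
  rw [← QuotientGroup.eq_one_iff]
  simp only [QuotientGroup.mk_mul, QuotientGroup.mk_inv]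
  rw [mul_inv_eq_one, mul_inv_eq_iff_eq_mul, eq_comm]

instance centMod_normal (S R : Subgroup G) [S.Normal] [R.Normal] : (centMod S R).Normal := by
  have : (R.map (QuotientGroup.mk' S)).Normal :=
    Subgroup.Normal.map inferInstance _ (QuotientGroup.mk'_surjective S)
  unfold centMod
  infer_instance

theorem card_map_mk' (S R : Subgroup G) [S.Normal] :
    Nat.card (R.map (QuotientGroup.mk' S)) = S.relIndex R := by
  rw [← Subgroup.relIndex_ker, QuotientGroup.ker_mk']

/-- A nontrivial `p`-group has a proper derived subgroup, which is trivial here because the factor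
is chief. -/
theorem IsChief.le_centMod [Finite G] {p k : ℕ} (hp : p.Prime) {S R : Subgroup G} [S.Normal]
    (h : IsChief S R) (hk : S.relIndex R = p ^ k) : R ≤ centMod S R := by
  have := h.normal_right
  have := Fact.mk hp
  let Q := R.map (QuotientGroup.mk' S)
  have hQ : IsPGroup p Q := IsPGroup.of_card (n := k) (by rw [card_map_mk', hk])
  have hnil : Group.IsNilpotent Q := hQ.isNilpotent
  have hsol : Group.IsSolvable Q := inferInstance
  have hRQ : ⁅R, R⁆ ⊔ S = S := by
    refine (h.eq_or_eq _ inferInstance le_sup_right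
      (sup_le (Subgroup.commutator_le_left R R) h.lt.le)).resolve_right fun he => ?_
    have hQQ : ⁅Q, Q⁆ = Q := by
      have := congrArg (Subgroup.map (QuotientGroup.mk' S)) he
      rwa [Subgroup.map_sup, Subgroup.map_commutator, QuotientGroup.map_mk'_self, sup_bot_eq]
        at this
    have hne : Nontrivial Q := by
      rw [Subgroup.nontrivial_iff_ne_bot]
      intro hb
      rw [Subgroup.map_eq_bot_iff, QuotientGroup.ker_mk'] at hb
      exact h.lt.not_ge hb
    have hlt := Group.IsSolvable.commutator_lt_top_of_nontrivial Q
    refine hlt.ne (Subgroup.map_injective Q.subtype_injective ?_)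
    rw [commutator_def, Subgroup.map_commutator]
    simpa [← MonoidHom.range_eq_map] using hQQ
  intro a ha
  rw [mem_centMod]
  intro b hb
  rw [← commutatorElement_def]
  exact hRQ ▸ Subgroup.mem_sup_left (Subgroup.commutator_mem_commutator ha hb)

/-- The elements of `R` with `p`-th power in `S` form a normal subgroup, strictly above `S` by
Cauchy, hence equal to `R`. -/
theorem IsChief.pow_mem [Finite G] {p k : ℕ} (hp : p.Prime) {S R : Subgroup G}
    (h : IsChief S R) (hk : S.relIndex R = p ^ k) {r : G} (hr : r ∈ R) : r ^ p ∈ S := by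
  have := h.normal_left
  have := h.normal_right
  have := Fact.mk hp
  have hab := h.le_centMod hp hk
  have hcomm : ∀ a ∈ R, ∀ b ∈ R, Commute (a : G ⧸ S) b := fun a ha b hb => by
    have := mem_centMod.1 (hab ha) b hb
    rw [← QuotientGroup.eq_one_iff] at this
    simp only [QuotientGroup.mk_mul, QuotientGroup.mk_inv] at this
    rwa [mul_inv_eq_one, mul_inv_eq_iff_eq_mul] at this
  let T : Subgroup G :=
    { carrier := {r | r ∈ R ∧ r ^ p ∈ S}
      one_mem' := ⟨R.one_mem, by simp⟩
      mul_mem' := by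
        rintro a b ⟨ha, ha'⟩ ⟨hb, hb'⟩
        refine ⟨R.mul_mem ha hb, ?_⟩
        rw [← QuotientGroup.eq_one_iff] at ha' hb' ⊢
        simp only [QuotientGroup.mk_mul, QuotientGroup.mk_pow] at ha' hb' ⊢
        rw [(hcomm a ha b hb).mul_pow, ha', hb', one_mul]
      inv_mem' := by
        rintro a ⟨ha, ha'⟩
        exact ⟨R.inv_mem ha, by rw [inv_pow]; exact S.inv_mem ha'⟩ }
  have hT : T.Normal := ⟨fun a ha g => ⟨h.normal_right.conj_mem a ha.1 g, by
    rw [conj_pow]; exact h.normal_left.conj_mem _ ha.2 g⟩⟩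
  have hTR : T = R := by
    refine (h.eq_or_eq T hT (fun s hs => ⟨h.lt.le hs, S.pow_mem hs p⟩)
      fun a ha => ha.1).resolve_left fun he => ?_
    have hpd : p ∣ Nat.card (R.map (QuotientGroup.mk' S)) := by
      rw [card_map_mk', hk]
      refine dvd_pow_self p fun hk0 => ?_
      rw [hk0, pow_zero, Subgroup.relIndex_eq_one] at hk
      exact h.lt.not_ge hk
    obtain ⟨⟨x, hx⟩, hxp⟩ := exists_prime_orderOf_dvd_card' p hpd
    obtain ⟨a, ha, rfl⟩ := hx
    have haT : a ∈ T := by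
      refine ⟨ha, ?_⟩
      rw [← QuotientGroup.eq_one_iff]
      have := pow_orderOf_eq_one (⟨QuotientGroup.mk' S a, Subgroup.mem_map_of_mem _ ha⟩ :
        R.map (QuotientGroup.mk' S))
      rw [hxp] at this
      exact congrArg Subtype.val this
    rw [he] at haT
    have h1 : (⟨QuotientGroup.mk' S a, Subgroup.mem_map_of_mem _ ha⟩ :
        R.map (QuotientGroup.mk' S)) = 1 := Subtype.ext ((QuotientGroup.eq_one_iff a).2 haT)
    rw [h1, orderOf_one] at hxp
    exact hp.one_lt.ne hxp
  exact (hTR ▸ hr : r ∈ T).2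

/-- `R ⊓ M` is normalized by `M`, and by `R` because `R / S` is abelian and `S ≤ M`; these two
generate `G`. -/
theorem IsChief.inf_coatom {S R M : Subgroup G} [S.Normal] (h : IsChief S R)
    (hab : R ≤ centMod S R) (hM : IsCoatom M) (hSM : S ≤ M) (hRM : ¬ R ≤ M) : R ⊓ M = S := by
  have := h.normal_right
  have htop : R ⊔ M = ⊤ := hM.2 _ (lt_of_le_of_ne le_sup_right fun he => hRM (he ▸ le_sup_left))
  have hn : (R ⊓ M).Normal := by
    rw [← Subgroup.normalizer_eq_top_iff, ← top_le_iff, ← htop]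
    refine sup_le (Subgroup.le_normalizer_iff.2 ?_) (Subgroup.le_normalizer_iff.2 ?_)
    · rintro r hr t ⟨htR, htM⟩
      refine ⟨R.mul_mem (R.mul_mem hr htR) (R.inv_mem hr), ?_⟩
      have := M.mul_mem (hSM (mem_centMod.1 (hab hr) t htR)) htM
      simpa using this
    · rintro m hm t ⟨htR, htM⟩
      exact ⟨h.normal_right.conj_mem t htR m, M.mul_mem (M.mul_mem hm htM) (M.inv_mem hm)⟩
  exact (h.eq_or_eq _ hn (le_inf h.lt.le hSM) inf_le_left).resolve_right fun he =>
    hRM (inf_eq_left.1 he)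

/-- Since `R M = G` and `S ≤ M`, the index of `M` divides `|R : S|`; a prime dividing it therefore
excludes the `p'` alternative. -/
theorem IsChief.exists_prime [Finite G] {S R M : Subgroup G} (h : IsChief S R)
    (hM : IsCoatom M) (hSM : S ≤ M) (hRM : ¬ R ≤ M)
    (hps : ∀ p : ℕ, p.Prime → p ∣ M.index → IsPSolvable p G) :
    ∃ p k : ℕ, p.Prime ∧ IsPSolvable p G ∧ S.relIndex R = p ^ k := by
  have := h.normal_right
  have htop : R ⊔ M = ⊤ := hM.2 _ (lt_of_le_of_ne le_sup_right fun he => hRM (he ▸ le_sup_left))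
  have hidx : M.index ≠ 1 := fun h1 => hM.1 (Subgroup.index_eq_one.1 h1)
  obtain ⟨p, hp, hpd⟩ := Nat.exists_prime_and_dvd hidx
  have hps := hps p hp hpd
  have h1 : M.index ∣ S.relIndex R := by
    have hdvd : M.relIndex R ∣ S.relIndex R := Subgroup.relIndex_dvd_of_le_left _ hSM
    have : M.index = M.relIndex R := by
      have e2 : R.relIndex M = R.index := by
        rw [← Subgroup.relIndex_sup_left, htop, Subgroup.relIndex_top_right]
      have e3 : Nat.card (R ⊓ M : Subgroup G) * R.relIndex M = Nat.card M := by
        rw [← Subgroup.relIndex_bot_left, ← Subgroup.inf_relIndex_right R M,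
          Subgroup.relIndex_mul_relIndex _ _ _ bot_le inf_le_right, Subgroup.relIndex_bot_left]
      have e4 : Nat.card (R ⊓ M : Subgroup G) * M.relIndex R = Nat.card R := by
        rw [← Subgroup.relIndex_bot_left, ← Subgroup.inf_relIndex_left R M,
          Subgroup.relIndex_mul_relIndex _ _ _ bot_le inf_le_left, Subgroup.relIndex_bot_left]
      have e5 := Subgroup.card_mul_index R
      have e6 := Subgroup.card_mul_index M
      have hpos : 0 < Nat.card (R ⊓ M : Subgroup G) := Nat.card_pos
      have hpos' : 0 < R.index := Nat.pos_of_ne_zero Subgroup.index_ne_zero_of_finite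
      rw [e2] at e3
      rw [← e4] at e5
      rw [← e3, ← e5] at e6
      have : Nat.card (R ⊓ M : Subgroup G) * R.index * M.index =
        Nat.card (R ⊓ M : Subgroup G) * R.index * M.relIndex R := by rw [e6]; ring
      exact Nat.eq_of_mul_eq_mul_left (Nat.mul_pos hpos hpos') this
    rwa [this]
  rcases h.relIndex_eq_pow_or hp hps with ⟨k, hk⟩ | hk
  · exact ⟨p, k, hp, hps, hk⟩
  · exact absurd (hpd.trans h1) hk

theorem IsChief.inf_normalCore {S R M : Subgroup G} [S.Normal] (h : IsChief S R)
    (hab : R ≤ centMod S R) (hM : IsCoatom M) (hSM : S ≤ M) (hRM : ¬ R ≤ M) :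
    R ⊓ M.normalCore = S :=
  le_antisymm ((inf_le_inf_left R M.normalCore_le).trans (h.inf_coatom hab hM hSM hRM).le)
    (le_inf h.lt.le (Subgroup.normal_le_normalCore.2 hSM))

theorem IsChief.centMod_inf_normal {S R M : Subgroup G} [S.Normal] (h : IsChief S R)
    (hM : IsCoatom M) (hSM : S ≤ M) (hRM : ¬ R ≤ M) :
    (centMod S R ⊓ M).Normal := by
  have := h.normal_right
  have htop : R ⊔ M = ⊤ := hM.2 _ (lt_of_le_of_ne le_sup_right fun he => hRM (he ▸ le_sup_left))
  rw [← Subgroup.normalizer_eq_top_iff, ← top_le_iff, ← htop]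
  refine sup_le (Subgroup.le_normalizer_iff.2 ?_) (Subgroup.le_normalizer_iff.2 ?_)
  · rintro r hr t ⟨htC, htM⟩
    refine ⟨(centMod_normal S R).conj_mem t htC r, ?_⟩
    have := M.mul_mem (hSM (S.inv_mem (mem_centMod.1 htC r hr))) htM
    have e : (t * r * t⁻¹ * r⁻¹)⁻¹ * t = r * t * r⁻¹ := by group
    rwa [e] at this
  · rintro m hm t ⟨htC, htM⟩
    exact ⟨(centMod_normal S R).conj_mem t htC m, M.mul_mem (M.mul_mem hm htM) (M.inv_mem hm)⟩

/-- Another minimal normal subgroup would meet the image of `R` trivially, so its preimage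
centralizes `R / S`. But `centMod S R ≤ R ⊔ M.normalCore`, since `centMod S R ⊓ M` is normal in `G`,
and this puts it inside the image of `R` after all. -/
theorem IsChief.XM_eq_map {S R M : Subgroup G} [S.Normal] (h : IsChief S R)
    (hab : R ≤ centMod S R) (hM : IsCoatom M) (hSM : S ≤ M) (hRM : ¬ R ≤ M) :
    XM M = R.map (QuotientGroup.mk' M.normalCore) := by
  have := h.normal_right
  have htop : R ⊔ M = ⊤ := hM.2 _ (lt_of_le_of_ne le_sup_right fun he => hRM (he ▸ le_sup_left))
  have hSL : S ≤ M.normalCore := Subgroup.normal_le_normalCore.2 hSM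
  have hRL := h.inf_normalCore hab hM hSM hRM
  have hXn : (R.map (QuotientGroup.mk' M.normalCore)).Normal :=
    Subgroup.Normal.map inferInstance _ (QuotientGroup.mk'_surjective _)
  have hmin : IsMinimalNormal (R.map (QuotientGroup.mk' M.normalCore)) := by
    refine ⟨hXn, fun hb => ?_, fun K hK hK0 hKX => ?_⟩
    · rw [Subgroup.map_eq_bot_iff, QuotientGroup.ker_mk'] at hb
      exact hRM (hb.trans M.normalCore_le)
    · rcases h.eq_or_eq (R ⊓ K.comap (QuotientGroup.mk' M.normalCore)) inferInstance
        (le_inf h.lt.le fun s hs => by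
          rw [Subgroup.mem_comap, QuotientGroup.mk'_apply, (QuotientGroup.eq_one_iff s).2 (hSL hs)]
          exact K.one_mem) inf_le_left with he | he
      · refine absurd ((Subgroup.eq_bot_iff_forall K).2 fun k hk => ?_) hK0
        obtain ⟨r, hr, rfl⟩ := hKX hk
        have : r ∈ R ⊓ K.comap (QuotientGroup.mk' M.normalCore) := ⟨hr, hk⟩
        rw [he] at this
        exact (QuotientGroup.eq_one_iff r).2 (hSL this)
      · exact le_antisymm hKX (Subgroup.map_le_iff_le_comap.2 (inf_eq_left.1 he))
  refine XM_eq_of_unique M _ hmin fun Y hY => ?_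
  have hYn := hY.1
  by_cases hYX : Y ⊓ R.map (QuotientGroup.mk' M.normalCore) = ⊥
  · have hYC : Y.comap (QuotientGroup.mk' M.normalCore) ≤ centMod S R := by
      intro y hy
      rw [mem_centMod]
      intro r hr
      have h1 : y * r * y⁻¹ * r⁻¹ ∈ R := R.mul_mem (h.normal_right.conj_mem r hr y) (R.inv_mem hr)
      have h2 : QuotientGroup.mk' M.normalCore (y * r * y⁻¹ * r⁻¹) ∈
          Y ⊓ R.map (QuotientGroup.mk' M.normalCore) := by
        refine ⟨?_, Subgroup.mem_map_of_mem _ h1⟩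
        have := Y.mul_mem hy (hYn.conj_mem _ (Y.inv_mem hy) (QuotientGroup.mk' M.normalCore r))
        simpa [mul_assoc] using this
      rw [hYX, Subgroup.mem_bot, QuotientGroup.mk'_apply, QuotientGroup.eq_one_iff] at h2
      exact hRL ▸ ⟨h1, h2⟩
    have hCL : centMod S R ⊓ M ≤ M.normalCore := by
      have := h.centMod_inf_normal hM hSM hRM
      exact Subgroup.normal_le_normalCore.2 inf_le_right
    have hC : centMod S R ≤ R ⊔ M.normalCore := by
      refine (le_sup_inf_of_normal hab htop).trans ?_
      exact sup_le_sup_left (inf_comm M (centMod S R) ▸ hCL) R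
    have hYle : Y ≤ R.map (QuotientGroup.mk' M.normalCore) := by
      have := Subgroup.map_mono (f := QuotientGroup.mk' M.normalCore) (hYC.trans hC)
      rwa [Subgroup.map_comap_eq_self_of_surjective (QuotientGroup.mk'_surjective _),
        Subgroup.map_sup, QuotientGroup.map_mk'_self, sup_bot_eq] at this
    exact absurd (inf_eq_left.2 hYle ▸ hYX) hY.2.1
  · have h1 := hY.2.2 _ inferInstance hYX inf_le_left
    exact hmin.2.2 _ hYn hY.2.1 (inf_eq_left.1 h1)

/-- Identifies $X_M$ with `R / S` equivariantly. It is stated through a surjection from `R` so that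
different groups can be compared by their kernels in `R`. -/
theorem IsChief.exists_hom {S R M : Subgroup G} [S.Normal] (h : IsChief S R)
    (hab : R ≤ centMod S R) (hM : IsCoatom M) (hSM : S ≤ M) (hRM : ¬ R ≤ M) :
    ∃ f : R →* XM M, Function.Surjective f ∧ (∀ r, f r = 1 ↔ (r : G) ∈ S) ∧
      ∀ (g : G) (r s : R), (s : G) = g * r * g⁻¹ → f s = conjAction M g (f r) := by
  have hX := h.XM_eq_map hab hM hSM hRM
  refine ⟨((QuotientGroup.mk' M.normalCore).comp R.subtype).codRestrict (XM M) fun r => ?_,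
    ?_, ?_, ?_⟩
  · rw [hX]; exact Subgroup.mem_map_of_mem _ r.2
  · rintro ⟨x, hx⟩
    have hx' := hx
    rw [hX] at hx'
    obtain ⟨r, hr, rfl⟩ := hx'
    exact ⟨⟨r, hr⟩, rfl⟩
  · intro r
    rw [Subtype.ext_iff]
    change (r : G ⧸ M.normalCore) = 1 ↔ _
    rw [QuotientGroup.eq_one_iff, ← h.inf_normalCore hab hM hSM hRM]
    exact ⟨fun h => ⟨r.2, h⟩, fun h => h.2⟩
  · intro g r s hs
    ext1
    simp [conjAction, hs]

theorem exists_mulEquiv_of_surjective {K X Y : Type*} [Group K] [Group X] [Group Y]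
    (f : K →* X) (g : K →* Y) (hf : Function.Surjective f) (hg : Function.Surjective g)
    (h : ∀ k, f k = 1 ↔ g k = 1) : ∃ e : X ≃* Y, ∀ k, e (f k) = g k := by
  have hk : f.ker = g.ker := by ext k; simpa using h k
  refine ⟨(QuotientGroup.quotientKerEquivOfSurjective f hf).symm.trans
    ((QuotientGroup.quotientMulEquivOfEq hk).trans
      (QuotientGroup.quotientKerEquivOfSurjective g hg)), fun k => ?_⟩
  have : (QuotientGroup.quotientKerEquivOfSurjective f hf).symm (f k) = (k : K ⧸ f.ker) := by
    rw [MulEquiv.symm_apply_eq]; rfl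
  rw [MulEquiv.trans_apply, this]
  rfl

theorem IsChief.gIso {S R M M' : Subgroup G} [S.Normal] (h : IsChief S R)
    (hab : R ≤ centMod S R) (hM : IsCoatom M) (hSM : S ≤ M) (hRM : ¬ R ≤ M)
    (hM' : IsCoatom M') (hSM' : S ≤ M') (hRM' : ¬ R ≤ M') :
    GIso (conjAction M) (conjAction M') := by
  obtain ⟨f, hf, hfS, hfg⟩ := h.exists_hom hab hM hSM hRM
  obtain ⟨f', hf', hfS', hfg'⟩ := h.exists_hom hab hM' hSM' hRM'
  obtain ⟨e, he⟩ := exists_mulEquiv_of_surjective f f' hf hf' fun r => by rw [hfS, hfS']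
  refine ⟨e, fun g x => ?_⟩
  obtain ⟨r, rfl⟩ := hf x
  rw [← hfg g r ⟨g * r * g⁻¹, h.normal_right.conj_mem r r.2 g⟩ rfl, he, he]
  exact hfg' g r _ rfl

/-- In a family of maximal subgroups no two of which complement the same chief factor, the product
of the intersection with a normal subgroup `N` is the intersection of the members above `N`. -/
theorem iInf_sup_eq [Finite G] {ι : Type*} (M : ι → Subgroup G) (hM : ∀ i, IsCoatom (M i))
    (hinj : ∀ S R, IsChief S R → ∀ i j, S ≤ M i → ¬ R ≤ M i → S ≤ M j → ¬ R ≤ M j → i = j)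
    (N : Subgroup G) (hN : N.Normal) :
    (⨅ i, M i) ⊔ N = ⨅ (i) (_ : N ≤ M i), M i := by
  induction hc : Nat.card N using Nat.strong_induction_on generalizing N with
  | _ c ih =>
  by_cases hb : N = ⊥
  · subst hb; simp
  obtain ⟨S, hS⟩ := exists_isChief_below hN hb
  have hcard : Nat.card S < c := hc ▸ Set.Finite.card_lt_card (Set.toFinite _) hS.lt
  have ihS := ih _ hcard S hS.normal_left rfl
  have hle : (⨅ i, M i) ⊔ N = (⨅ (i) (_ : S ≤ M i), M i) ⊔ N := by
    rw [← ihS, sup_assoc, sup_eq_right.2 hS.lt.le]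
  rw [hle]
  refine le_antisymm (sup_le ?_ (le_iInf₂ fun i hi => hi)) ?_
  · exact le_iInf₂ fun i hi => iInf₂_le i (hS.lt.le.trans hi)
  by_cases hex : ∃ i, S ≤ M i ∧ ¬ N ≤ M i
  · obtain ⟨i, hSi, hNi⟩ := hex
    have htop : M i ⊔ N = ⊤ :=
      (hM i).2 _ (lt_of_le_of_ne le_sup_left fun he => hNi (he ▸ le_sup_right))
    -- Dedekind's law reduces the claim to `M i ⊓ ⨅ ...`; as `M i` is the only member above `S` and
    -- not above `N`, this lies in every member above `S`.
    calc ⨅ (j) (_ : N ≤ M j), M j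
        ≤ N ⊔ M i ⊓ ⨅ (j) (_ : N ≤ M j), M j :=
          le_sup_inf_of_normal (le_iInf₂ fun j hj => hj) (sup_comm N (M i) ▸ htop)
      _ ≤ (⨅ (j) (_ : S ≤ M j), M j) ⊔ N := by
          refine sup_le le_sup_right (le_trans ?_ le_sup_left)
          refine le_iInf₂ fun j hj => ?_
          by_cases hNj : N ≤ M j
          · exact inf_le_right.trans (iInf₂_le j hNj)
          · rw [← hinj S N hS i j hSi hNi hj hNj]; exact inf_le_left
  · push Not at hex
    exact le_sup_of_le_left (le_iInf₂ fun j hj => iInf₂_le j (hex j hj))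

end ChiefFactors

/-! ### Lifts centralizing a homogeneous normal subgroup -/

section Lifts

variable {G V : Type*} [Group G] [AddCommGroup V] [Module ℂ V]

/-- Nonzero scalars as units of `End V`. -/
noncomputable def scalarUnit (V : Type*) [AddCommGroup V] [Module ℂ V] :
    ℂˣ →* (Module.End ℂ V)ˣ :=
  Units.map (algebraMap ℂ (Module.End ℂ V)).toMonoidHom

theorem coe_scalarUnit (c : ℂˣ) :
    (scalarUnit V c : Module.End ℂ V) = (c : ℂ) • (1 : Module.End ℂ V) :=
  Algebra.algebraMap_eq_smul_one (c : ℂ)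

theorem scalarUnit_comm (c : ℂˣ) (u : (Module.End ℂ V)ˣ) :
    scalarUnit V c * u = u * scalarUnit V c :=
  Units.ext (by simp [coe_scalarUnit])

theorem scalarUnit_injective [Nontrivial V] : Function.Injective (scalarUnit V) :=
  Units.map_injective (algebraMap ℂ (Module.End ℂ V)).injective

/-- A representation as a homomorphism to the units of `End V`. -/
def unitRep (ρ : Representation ℂ G V) : G →* (Module.End ℂ V)ˣ := MonoidHom.toHomUnits ρ

@[simp]
theorem coe_unitRep (ρ : Representation ℂ G V) (g : G) :
    (unitRep ρ g : Module.End ℂ V) = ρ g := rfl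

@[simp]
theorem coe_unitRep_inv (ρ : Representation ℂ G V) (g : G) :
    (↑(unitRep ρ g)⁻¹ : Module.End ℂ V) = ρ g⁻¹ := by
  rw [← map_inv]; rfl

/-- The unit `u` of `End V` centralizes `S` and lies in `ρ g` times the span of `S`. -/
def IsLift (ρ : Representation ℂ G V) (S : Subgroup G) (g : G) (u : (Module.End ℂ V)ˣ) : Prop :=
  (u : Module.End ℂ V) ∈ commutant ρ S ∧ ρ g⁻¹ * u ∈ spanAlg ρ S

variable {ρ : Representation ℂ G V} {S R : Subgroup G} {g h : G} {u v : (Module.End ℂ V)ˣ}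

theorem isLift_scalarUnit (c : ℂˣ) : IsLift ρ S 1 (scalarUnit V c) := by
  rw [IsLift, coe_scalarUnit, inv_one, map_one, one_mul]
  exact ⟨Subalgebra.smul_mem _ (one_mem _) _, Subalgebra.smul_mem _ (one_mem _) _⟩

theorem IsLift.mul (hu : IsLift ρ S g u) (hv : IsLift ρ S h v) : IsLift ρ S (g * h) (u * v) := by
  refine ⟨mul_mem hu.1 hv.1, ?_⟩
  have : ρ (g * h)⁻¹ * ↑(u * v) = ρ h⁻¹ * v * (ρ g⁻¹ * u) := by
    rw [mul_assoc, ← commute_of_mem_spanAlg hu.2 hv.1, mul_inv_rev, map_mul, Units.val_mul]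
    simp only [mul_assoc]
  rw [this]
  exact mul_mem hv.2 hu.2

theorem IsLift.of_mem (hu : IsLift ρ S g u) (h' : h⁻¹ * g ∈ S) : IsLift ρ S h u := by
  refine ⟨hu.1, ?_⟩
  have : ρ h⁻¹ * (u : Module.End ℂ V) = ρ (h⁻¹ * g) * (ρ g⁻¹ * u) := by
    rw [← mul_assoc, ← map_mul]; simp
  rw [this]
  exact mul_mem (apply_mem_spanAlg h') hu.2

theorem IsLift.conj (hS : S.Normal) (hu : IsLift ρ S g u) (k : G) :
    IsLift ρ S (k * g * k⁻¹) (unitRep ρ k * u * (unitRep ρ k)⁻¹) := by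
  refine ⟨by simpa using conj_mem_commutant hS k hu.1, ?_⟩
  have : ρ (k * g * k⁻¹)⁻¹ * ↑(unitRep ρ k * u * (unitRep ρ k)⁻¹) =
      ρ k * (ρ g⁻¹ * u) * ρ k⁻¹ := by
    simp only [Units.val_mul, coe_unitRep, coe_unitRep_inv, ← mul_assoc, ← map_mul]
    simp [mul_assoc]
  rw [this]
  exact conj_mem_spanAlg hS k hu.2

/-- The trace of `u` is a linear combination of the values of the character on the coset `g S`. -/
theorem IsLift.trace_eq_zero (hu : IsLift ρ S g u) (hg : ∀ s ∈ S, ρ.character (g * s) = 0) :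
    LinearMap.trace ℂ V u = 0 := by
  have h1 : (u : Module.End ℂ V) = ρ g * (ρ g⁻¹ * u) := by
    rw [← mul_assoc, ← map_mul]; simp
  have h2 : ∀ a ∈ spanAlg ρ S, LinearMap.trace ℂ V (ρ g * a) = 0 := fun a ha => by
    induction ha using spanAlg_induction with
    | hsmul n hn c =>
      rw [mul_smul_comm, map_smul, ← map_mul]
      exact (congrArg (c • ·) (hg n hn)).trans (smul_zero c)
    | hadd a b _ _ ha hb => rw [mul_add, map_add, ha, hb, add_zero]
  rw [h1]
  exact h2 _ hu.2

variable [Finite G] [FiniteDimensional ℂ V]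

theorem IsLift.inv (hS : S.Normal) (hu : IsLift ρ S g u) : IsLift ρ S g⁻¹ u⁻¹ := by
  have hC : ∀ (w : (Module.End ℂ V)ˣ) (c : Module.End ℂ V), (w : Module.End ℂ V) * c = c * w →
      (↑w⁻¹ : Module.End ℂ V) * c = c * ↑w⁻¹ := fun w c hw => by
    rw [Units.inv_mul_eq_iff_eq_mul, ← mul_assoc, hw, mul_assoc, Units.mul_inv, mul_one]
  refine ⟨mem_commutant.2 fun n hn => (hC u _ (mem_commutant.1 hu.1 n hn).symm).symm, ?_⟩
  have h1 : (↑((unitRep ρ g)⁻¹ * u)⁻¹ : Module.End ℂ V) ∈ spanAlg ρ S :=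
    mem_spanAlg_of_commute _ fun c hc => hC _ _ (by
      simpa using commute_of_mem_spanAlg hu.2 hc)
  have h2 : ρ g⁻¹⁻¹ * (↑u⁻¹ : Module.End ℂ V) =
      ρ g * ↑((unitRep ρ g)⁻¹ * u)⁻¹ * ρ g⁻¹ := by
    rw [← coe_unitRep_inv, ← coe_unitRep ρ g, ← coe_unitRep ρ, ← Units.val_mul, ← Units.val_mul,
      ← Units.val_mul, map_inv]
    congr 1
    group
  rw [h2]
  exact conj_mem_spanAlg hS g h1

/-- The quotient of two lifts of `g` is a lift of `1`, hence in the centre of the span of `S`. -/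
theorem IsLift.exists_scalar [Nontrivial V] (hS : S.Normal) (hom : IsHomogeneous ρ S)
    (hu : IsLift ρ S g u) (hv : IsLift ρ S g v) : ∃ c : ℂˣ, u = scalarUnit V c * v := by
  have h1 := hu.mul (hv.inv hS)
  rw [mul_inv_cancel] at h1
  obtain ⟨c, hc⟩ := hom _ (by simpa using h1.2) h1.1
  have hc0 : c ≠ 0 := by
    rintro rfl
    rw [zero_smul] at hc
    exact (u * v⁻¹).ne_zero hc
  refine ⟨Units.mk0 c hc0, ?_⟩
  rw [← mul_inv_eq_iff_eq_mul]
  exact Units.ext (by rw [hc, coe_scalarUnit]; rfl)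

theorem IsLift.exists_scalar_of_one [Nontrivial V] (hS : S.Normal) (hom : IsHomogeneous ρ S)
    (hu : IsLift ρ S g u) (hg : g ∈ S) : ∃ c : ℂˣ, u = scalarUnit V c := by
  have h1 : IsLift ρ S 1 u := hu.of_mem (by simpa using hg)
  simpa using h1.exists_scalar hS hom (isLift_scalarUnit 1)

/-- The data of a chief-factor-like section `R / S` with `S` homogeneous and with the character
vanishing on `R \ S`. -/
structure IsVanishing (ρ : Representation ℂ G V) (S R : Subgroup G) : Prop where
  normal_left : S.Normal
  normal_right : R.Normal
  le : S ≤ R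
  homogeneous : IsHomogeneous ρ S
  vanish : ∀ r ∈ R, r ∉ S → ρ.character r = 0

omit [Finite G] [FiniteDimensional ℂ V] in
theorem IsVanishing.trace_eq_zero (H : IsVanishing ρ S R) (hg : g ∈ R) (hgS : g ∉ S) (hu : IsLift ρ S g u) :
    LinearMap.trace ℂ V u = 0 :=
  hu.trace_eq_zero fun _ hs => H.vanish _ (R.mul_mem hg (H.le hs)) fun h =>
    hgS ((S.mul_mem_cancel_right hs).1 h)

variable [Nontrivial V]

/-- A lift determines its coset of `S`: otherwise the identity, a lift of `g⁻¹ * h`, would have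
trace zero. -/
theorem IsVanishing.inv_mul_mem (H : IsVanishing ρ S R) (hg : g ∈ R) (hh : h ∈ R) (hu : IsLift ρ S g u)
    (hu' : IsLift ρ S h u) : g⁻¹ * h ∈ S := by
  by_contra hgh
  have := H.trace_eq_zero (R.mul_mem (R.inv_mem hg) hh) hgh ((hu.inv H.normal_left).mul hu')
  rw [inv_mul_cancel, Units.val_one, LinearMap.trace_one] at this
  exact finrank_pos.ne' (Nat.cast_eq_zero.1 this)

theorem IsVanishing.exists_conj_eq (H : IsVanishing ρ S R) [S.Normal] {k r : G} (hk : k ∈ centMod S R) (hr : r ∈ R)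
    (hu : IsLift ρ S r u) :
    ∃ c : ℂˣ, unitRep ρ k * u * (unitRep ρ k)⁻¹ = scalarUnit V c * u := by
  refine IsLift.exists_scalar H.normal_left H.homogeneous ((hu.conj H.normal_left k).of_mem ?_) hu
  have := H.normal_left.conj_mem _ (mem_centMod.1 hk r hr) r⁻¹
  simpa [mul_assoc] using this

/-- If only the lifts of elements of `S` commute with `R`, then `R` is homogeneous. -/
theorem IsVanishing.homogeneous_of_nondegenerate (H : IsVanishing ρ S R) [S.Normal] (hab : R ≤ centMod S R)
    (hnd : ∀ r ∈ R, (∀ u, IsLift ρ S r u → ∀ t ∈ R, unitRep ρ t * u = u * unitRep ρ t) → r ∈ S) :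
    IsHomogeneous ρ R := by
  have := Fintype.ofFinite S
  have := Fintype.ofFinite R
  let avg : (N : Subgroup G) → [Fintype N] → Module.End ℂ V → Module.End ℂ V :=
    fun N _ a => ∑ n : N, ρ n * a * ρ (n : G)⁻¹
  have avg_add : ∀ (N : Subgroup G) [Fintype N] (a b), avg N (a + b) = avg N a + avg N b :=
    fun N _ a b => by simp [avg, mul_add, add_mul, Finset.sum_add_distrib]
  have avg_smul : ∀ (N : Subgroup G) [Fintype N] (c : ℂ) (a), avg N (c • a) = c • avg N a :=
    fun N _ c a => by simp [avg, Finset.smul_sum]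
  have avg_eq : ∀ (N : Subgroup G) [Fintype N] (a), a ∈ commutant ρ N →
      avg N a = (Nat.card N : ℂ) • a := fun N _ a ha => by
    have : ∀ n : N, ρ n * a * ρ (n : G)⁻¹ = a := fun n => by
      rw [mem_commutant.1 ha n n.2, mul_assoc, ← map_mul, mul_inv_cancel, map_one, mul_one]
    simp [avg, this, ← Nat.cast_smul_eq_nsmul ℂ]
  have avg_mem : ∀ (N : Subgroup G) [Fintype N] (a), avg N a ∈ commutant ρ N := fun N _ a => by
    rw [mem_commutant]
    intro m hm
    simp only [avg, Finset.mul_sum, Finset.sum_mul]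
    rw [← Equiv.sum_comp (Equiv.mulLeft (⟨m, hm⟩ : N)) fun n : N => ρ n * a * ρ (n : G)⁻¹ * ρ m]
    refine Finset.sum_congr rfl fun n _ => ?_
    simp only [Equiv.coe_mulLeft, Subgroup.coe_mul, mul_inv_rev, map_mul, mul_assoc]
    rw [← map_mul ρ m⁻¹, inv_mul_cancel, map_one, mul_one]
  -- Averaging over `S` turns `ρ r` into a multiple of a lift. Averaging that over `R` gives 0 when
  -- some `t` in `R` multiplies the lift by a scalar other than 1, which happens for every `r ∉ S`.
  -- A central `z` is only multiplied by `|S| |R|`, so it is scalar.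
  have key : ∀ a ∈ spanAlg ρ R, ∃ c : ℂ, avg R (avg S a) = c • 1 := fun a ha => by
    induction ha using spanAlg_induction with
    | hadd a b _ _ ha hb =>
      obtain ⟨c, hc⟩ := ha
      obtain ⟨d, hd⟩ := hb
      exact ⟨c + d, by rw [avg_add, avg_add, hc, hd, add_smul]⟩
    | hsmul r hr c =>
      suffices ∃ c : ℂ, avg R (avg S (ρ r)) = c • 1 by
        obtain ⟨d, hd⟩ := this
        exact ⟨c * d, by rw [avg_smul, avg_smul, hd, mul_smul]⟩
      obtain ⟨u, hu⟩ := H.homogeneous.exists_unit H.normal_left r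
      have hu : IsLift ρ S r u := hu
      have hw : ρ r⁻¹ * avg S (ρ r) ∈ spanAlg ρ S := by
        simp only [avg, Finset.mul_sum]
        refine sum_mem fun s _ => ?_
        simp only [← map_mul]
        refine apply_mem_spanAlg ?_
        have := S.mul_mem (H.normal_left.conj_mem s s.2 r⁻¹) (S.inv_mem s.2)
        simpa [mul_assoc] using this
      obtain ⟨d, hd⟩ : ∃ d : ℂ, avg S (ρ r) = d • (u : Module.End ℂ V) := by
        have hui := hu.inv H.normal_left
        have h1 : (↑u⁻¹ : Module.End ℂ V) * avg S (ρ r) ∈ spanAlg ρ S := by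
          have e : (↑u⁻¹ : Module.End ℂ V) * avg S (ρ r) =
              ρ r⁻¹ * (ρ r⁻¹⁻¹ * ↑u⁻¹) * ρ r⁻¹⁻¹ * (ρ r⁻¹ * avg S (ρ r)) := by
            simp only [← mul_assoc, ← map_mul]
            simp only [mul_assoc, ← map_mul]
            simp only [inv_inv, inv_mul_cancel, map_one, one_mul, ← mul_assoc]
            rw [mul_inv_cancel, map_one, mul_one]
          rw [e]
          exact mul_mem (conj_mem_spanAlg H.normal_left _ hui.2) hw
        obtain ⟨d, hd⟩ := H.homogeneous _ h1 (mul_mem hui.1 (avg_mem S _))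
        refine ⟨d, ?_⟩
        rw [Units.inv_mul_eq_iff_eq_mul] at hd
        rw [hd, mul_smul_comm, mul_one]
      rw [hd, avg_smul]
      by_cases hrS : r ∈ S
      · obtain ⟨e, rfl⟩ := hu.exists_scalar_of_one H.normal_left H.homogeneous hrS
        refine ⟨d * ((Nat.card R : ℂ) * e), ?_⟩
        rw [coe_scalarUnit, avg_eq R _ (Subalgebra.smul_mem _ (one_mem _) _)]
        simp only [smul_smul]
      · have : ∃ t ∈ R, unitRep ρ t * u ≠ u * unitRep ρ t := by
          by_contra! hcon
          refine hrS (hnd r hr fun v hv t ht => ?_)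
          obtain ⟨e, rfl⟩ := hv.exists_scalar H.normal_left H.homogeneous hu
          rw [← mul_assoc, ← scalarUnit_comm, mul_assoc, hcon t ht, mul_assoc]
        obtain ⟨t, ht, htu⟩ := this
        obtain ⟨e, he⟩ := H.exists_conj_eq (hab ht) hr hu
        have he1 : (e : ℂ) ≠ 1 := fun h1 => by
          rw [Units.val_eq_one.1 h1, map_one, one_mul, mul_inv_eq_iff_eq_mul] at he
          exact htu he
        have he' : ρ t * u * ρ t⁻¹ = (e : ℂ) • (u : Module.End ℂ V) := by
          simpa [coe_scalarUnit] using congrArg Units.val he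
        have h0 : avg R u = (e : ℂ) • avg R u := by
          rw [← avg_smul, ← he']
          simp only [avg]
          rw [← Equiv.sum_comp (Equiv.mulRight (⟨t, ht⟩ : R))]
          refine Finset.sum_congr rfl fun n _ => ?_
          simp only [Equiv.coe_mulRight, Subgroup.coe_mul, mul_inv_rev, map_mul, mul_assoc]
        have h00 : avg R u = 0 := by
          have : (1 - (e : ℂ)) • avg R u = 0 := by rw [sub_smul, one_smul, ← h0, sub_self]
          exact (smul_eq_zero.1 this).resolve_left (sub_ne_zero.2 (Ne.symm he1))
        exact ⟨0, by rw [h00]; simp⟩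
  intro z hz hzC
  obtain ⟨c, hc⟩ := key z hz
  rw [avg_eq S z (commutant_anti H.le hzC), avg_smul, avg_eq R z hzC, smul_smul] at hc
  refine ⟨((Nat.card S : ℂ) * (Nat.card R : ℂ))⁻¹ * c, ?_⟩
  rw [mul_smul, ← hc, smul_smul, inv_mul_cancel₀, one_smul]
  simp

end Lifts

/-! ### Equal commutants, and separating groups of characters -/

section Constant

variable {G V : Type*} [Group G] [AddCommGroup V] [Module ℂ V] [Finite G] [FiniteDimensional ℂ V]
  {ρ : Representation ℂ G V} {S R : Subgroup G}

/-- By the double centralizer theorem equal commutants come from equal spans, so the centres agree.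
-/
theorem IsHomogeneous.of_commutant_eq (h : IsHomogeneous ρ S) (hSR : S ≤ R)
    (hC : commutant ρ R = commutant ρ S) : IsHomogeneous ρ R := fun z hz hzC =>
  h z (mem_spanAlg_of_commute z fun _ hc => commute_of_mem_spanAlg hz (hC ▸ hc))
    (commutant_anti hSR hzC)

end Constant

/-- Separation embeds `X` in the dual of the range of `F`, and finite abelian groups have as many
characters as elements, so the range is the whole dual. -/
theorem surjective_of_separating {X T : Type*} [Group X] [Finite X] [Group T]
    (hX : ∀ a b : X, a * b = b * a) (F : T →* (X →* ℂˣ))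
    (hF : ∀ x, (∀ t, F t x = 1) → x = 1) : Function.Surjective F := by
  let _ : CommGroup X := { (inferInstance : Group X) with mul_comm := hX }
  have : NeZero (Monoid.exponent X) := ⟨Monoid.exponent_ne_zero_of_finite⟩
  have : NeZero ((Monoid.exponent X : ℕ) : ℂ) := ⟨Nat.cast_ne_zero.2 (NeZero.ne _)⟩
  have hcX : Nat.card (X →* ℂˣ) = Nat.card X := CommGroup.card_monoidHom_of_hasEnoughRootsOfUnity X ℂ
  have : Finite (X →* ℂˣ) := Nat.finite_of_card_ne_zero (by rw [hcX]; exact Nat.card_pos.ne')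
  have : NeZero (Monoid.exponent F.range) := ⟨Monoid.exponent_ne_zero_of_finite⟩
  have : NeZero ((Monoid.exponent F.range : ℕ) : ℂ) := ⟨Nat.cast_ne_zero.2 (NeZero.ne _)⟩
  have hcY : Nat.card (F.range →* ℂˣ) = Nat.card F.range :=
    CommGroup.card_monoidHom_of_hasEnoughRootsOfUnity F.range ℂ
  have : Finite (F.range →* ℂˣ) := Nat.finite_of_card_ne_zero (by rw [hcY]; exact Nat.card_pos.ne')
  let ev : X →* (F.range →* ℂˣ) := MonoidHom.mk' (fun x => MonoidHom.mk' (fun l => l.1 x)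
    fun _ _ => rfl) fun a b => by ext l; simp
  have hev : Function.Injective ev := by
    rw [injective_iff_map_eq_one]
    intro x hx
    exact hF x fun t => DFunLike.congr_fun hx (⟨F t, t, rfl⟩ : F.range)
  have hle : Nat.card (X →* ℂˣ) ≤ Nat.card F.range := by
    rw [hcX, ← hcY]; exact Nat.card_le_card_of_injective ev hev
  rw [← MonoidHom.range_eq_top]
  exact Subgroup.eq_top_of_le_card _ hle

/-! ### The commutator pairing and the dual chief factor -/

section Dual

variable {G V : Type*} [Group G] [AddCommGroup V] [Module ℂ V]
  {ρ : Representation ℂ G V} {S R : Subgroup G} [S.Normal]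

/-- The elements of the centralizer of `R / S` that commute with all lifts of elements of `R`. -/
def liftKer (ρ : Representation ℂ G V) (S R : Subgroup G) [S.Normal] : Subgroup G where
  carrier := {k | k ∈ centMod S R ∧
    ∀ r ∈ R, ∀ u, IsLift ρ S r u → unitRep ρ k * u = u * unitRep ρ k}
  one_mem' := ⟨one_mem _, by simp⟩
  mul_mem' := by
    rintro a b ⟨ha, ha'⟩ ⟨hb, hb'⟩
    refine ⟨mul_mem ha hb, fun r hr u hu => ?_⟩
    rw [map_mul, mul_assoc, hb' r hr u hu, ← mul_assoc, ha' r hr u hu, mul_assoc]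
  inv_mem' := by
    rintro a ⟨ha, ha'⟩
    refine ⟨inv_mem ha, fun r hr u hu => ?_⟩
    rw [map_inv, inv_mul_eq_iff_eq_mul, ← mul_assoc, ha' r hr u hu, mul_inv_cancel_right]

theorem mem_liftKer {k : G} : k ∈ liftKer ρ S R ↔ k ∈ centMod S R ∧
    ∀ r ∈ R, ∀ u, IsLift ρ S r u → unitRep ρ k * u = u * unitRep ρ k := Iff.rfl

theorem liftKer_le : liftKer ρ S R ≤ centMod S R := fun _ h => h.1

theorem IsLift.conj_inv {g r : G} {u : (Module.End ℂ V)ˣ} (hu : IsLift ρ S r u) :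
    IsLift ρ S (g⁻¹ * r * g) ((unitRep ρ g)⁻¹ * u * unitRep ρ g) := by
  simpa using hu.conj inferInstance g⁻¹

instance liftKer_normal [R.Normal] : (liftKer ρ S R).Normal where
  conj_mem k hk g := by
    refine ⟨(centMod_normal S R).conj_mem k hk.1 g, fun r hr u hu => ?_⟩
    have hr' : g⁻¹ * r * g ∈ R := by
      simpa using (inferInstance : R.Normal).conj_mem r hr g⁻¹
    have := hk.2 _ hr' _ hu.conj_inv
    rw [map_mul, map_mul, map_inv]
    calc unitRep ρ g * unitRep ρ k * (unitRep ρ g)⁻¹ * u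
        = unitRep ρ g * (unitRep ρ k * ((unitRep ρ g)⁻¹ * u * unitRep ρ g)) * (unitRep ρ g)⁻¹ := by
          group
      _ = _ := by rw [this]; group

variable [Finite G] [FiniteDimensional ℂ V] [Nontrivial V] (H : IsVanishing ρ S R)
include H

omit [S.Normal] in
theorem IsVanishing.exists_lift (r : G) : ∃ u, IsLift ρ S r u :=
  H.homogeneous.exists_unit H.normal_left r

/-- Conjugation by a suitable lift multiplies `ρ k` by a scalar other than 1 and preserves its
trace. -/
theorem IsVanishing.character_eq_zero {k : G} (hk : k ∈ centMod S R) (hkV : k ∉ liftKer ρ S R) :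
    ρ.character k = 0 := by
  rw [mem_liftKer] at hkV
  push Not at hkV
  obtain ⟨r, hr, u, hu, hne⟩ := hkV hk
  obtain ⟨c, hc⟩ := H.exists_conj_eq hk hr hu
  have hc1 : (c : ℂ) ≠ 1 := fun h1 => by
    rw [Units.val_eq_one.1 h1, map_one, one_mul, mul_inv_eq_iff_eq_mul] at hc
    exact hne hc
  have h1 : u⁻¹ * unitRep ρ k * u = scalarUnit V c * unitRep ρ k := by
    rw [mul_inv_eq_iff_eq_mul] at hc
    rw [mul_assoc, hc, scalarUnit_comm, mul_assoc, inv_mul_cancel_left, scalarUnit_comm]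
  have h2 := congrArg (fun w : (Module.End ℂ V)ˣ => LinearMap.trace ℂ V w) h1
  simp only [Units.val_mul, coe_scalarUnit, coe_unitRep, smul_mul_assoc, one_mul, map_smul] at h2
  rw [LinearMap.trace_mul_comm, ← mul_assoc, Units.mul_inv, one_mul, smul_eq_mul] at h2
  have h3 : (1 - (c : ℂ)) * LinearMap.trace ℂ V (ρ k) = 0 := by
    rw [sub_mul, one_mul, ← h2, sub_self]
  exact (mul_eq_zero.1 h3).resolve_left (sub_ne_zero.2 (Ne.symm hc1))

/-- The scalar by which `k` moves a lift of `r` depends only on `r` modulo `S`, because lifts are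
unique up to central scalars; it is multiplicative in both arguments. -/
theorem IsVanishing.exists_dualHom {X : Type*} [Group X] (f : R →* X)
    (hf : Function.Surjective f) (hfS : ∀ r, f r = 1 ↔ (r : G) ∈ S) :
    ∃ F : centMod S R →* (X →* ℂˣ), ∀ (k : centMod S R) (r : R) u, IsLift ρ S r u →
      unitRep ρ k * u * (unitRep ρ k)⁻¹ = scalarUnit V (F k (f r)) * u := by
  have key : ∀ (k : centMod S R) (x : X), ∃ c : ℂˣ, ∀ (r : R) u, f r = x → IsLift ρ S r u →
      unitRep ρ k * u * (unitRep ρ k)⁻¹ = scalarUnit V c * u := by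
    intro k x
    obtain ⟨r₀, rfl⟩ := hf x
    obtain ⟨u₀, hu₀⟩ := H.exists_lift (r₀ : G)
    obtain ⟨c, hc⟩ := H.exists_conj_eq k.2 r₀.2 hu₀
    refine ⟨c, fun r u hr hu => ?_⟩
    have hmem : (r₀ : G)⁻¹ * r ∈ S := by
      rw [← R.coe_inv, ← R.coe_mul, ← hfS]; simp [hr]
    obtain ⟨d, rfl⟩ := (hu.of_mem hmem).exists_scalar H.normal_left H.homogeneous hu₀
    rw [← mul_assoc, ← scalarUnit_comm, mul_assoc, mul_assoc, ← mul_assoc (unitRep ρ _) u₀, hc,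
      ← mul_assoc, ← mul_assoc, scalarUnit_comm]
  choose ζ hζ using key
  have huniq : ∀ (k : centMod S R) (r : R) u (c : ℂˣ), IsLift ρ S r u →
      unitRep ρ k * u * (unitRep ρ k)⁻¹ = scalarUnit V c * u → ζ k (f r) = c := by
    intro k r u c hu h
    rw [hζ k (f r) r u rfl hu] at h
    exact scalarUnit_injective (mul_right_cancel h)
  refine ⟨MonoidHom.mk' (fun k => MonoidHom.mk' (ζ k) fun x y => ?_) fun k l => ?_,
    fun k r u hu => hζ k _ r u rfl hu⟩
  · obtain ⟨r, rfl⟩ := hf x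
    obtain ⟨s, rfl⟩ := hf y
    obtain ⟨u, hu⟩ := H.exists_lift (r : G)
    obtain ⟨v, hv⟩ := H.exists_lift (s : G)
    rw [← map_mul]
    refine huniq k (r * s) (u * v) _ (hu.mul hv) ?_
    calc unitRep ρ k * (u * v) * (unitRep ρ k)⁻¹
        = (unitRep ρ k * u * (unitRep ρ k)⁻¹) * (unitRep ρ k * v * (unitRep ρ k)⁻¹) := by group
      _ = _ := by
        rw [hζ k _ r u rfl hu, hζ k _ s v rfl hv, map_mul, mul_assoc, ← mul_assoc u,
          ← scalarUnit_comm _ u]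
        simp only [mul_assoc]
  · ext1 x
    obtain ⟨r, rfl⟩ := hf x
    obtain ⟨u, hu⟩ := H.exists_lift (r : G)
    refine huniq (k * l) r u _ hu ?_
    calc unitRep ρ ↑(k * l) * u * (unitRep ρ ↑(k * l))⁻¹
        = unitRep ρ k * (unitRep ρ l * u * (unitRep ρ l)⁻¹) * (unitRep ρ k)⁻¹ := by
          rw [Subgroup.coe_mul, map_mul]; group
      _ = _ := by
        rw [hζ l _ r u rfl hu, ← mul_assoc, ← scalarUnit_comm, mul_assoc, mul_assoc,
          ← mul_assoc _ u, hζ k _ r u rfl hu, MonoidHom.mul_apply, map_mul, ← mul_assoc,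
          ← map_mul, ← map_mul, mul_comm]
        rfl

/-- If the centralizer of the chief factor `R / S` acts nontrivially on the lifts, then modulo
`liftKer` it is a chief factor dual to `R / S`. -/
theorem IsVanishing.dual_chief {M : Subgroup G} (h : IsChief S R) (hab : R ≤ centMod S R)
    (hM : IsCoatom M) (hSM : S ≤ M) (hRM : ¬ R ≤ M) (hne : liftKer ρ S R ≠ centMod S R) :
    IsChief (liftKer ρ S R) (centMod S R) ∧
      ∀ M' : Subgroup G, IsCoatom M' → liftKer ρ S R ≤ M' → ¬ centMod S R ≤ M' →
        GIso (conjAction M') (dualAction (conjAction M)) := by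
  have := H.normal_right
  obtain ⟨f, hf, hfS, hfg⟩ := h.exists_hom hab hM hSM hRM
  obtain ⟨F, hF⟩ := H.exists_dualHom f hf hfS
  have hcomm : ∀ a b : XM M, a * b = b * a := by
    intro a b
    obtain ⟨r, rfl⟩ := hf a
    obtain ⟨s, rfl⟩ := hf b
    have := (hfS (r * s * r⁻¹ * s⁻¹)).2 (by simpa using mem_centMod.1 (hab r.2) s s.2)
    rwa [map_mul, map_mul, map_mul, map_inv, map_inv, mul_inv_eq_one, mul_inv_eq_iff_eq_mul] at this
  have hF1 : ∀ k (r : R) u, IsLift ρ S (r : G) u →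
      (F k (f r) = 1 ↔ unitRep ρ k * u = u * unitRep ρ k) := by
    intro k r u hu
    have := hF k r u hu
    constructor
    · intro h1
      rw [h1, map_one, one_mul, mul_inv_eq_iff_eq_mul] at this
      exact this
    · intro h1
      rw [h1, mul_inv_cancel_right] at this
      exact scalarUnit_injective (V := V) (by rw [map_one]; exact right_eq_mul.1 this)
  have hFker : ∀ k, F k = 1 ↔ (k : G) ∈ liftKer ρ S R := by
    intro k
    rw [mem_liftKer]
    constructor
    · exact fun h1 => ⟨k.2, fun r hr u hu => (hF1 k ⟨r, hr⟩ u hu).1 (by rw [h1]; rfl)⟩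
    · rintro ⟨-, h1⟩
      ext1 x
      obtain ⟨r, rfl⟩ := hf x
      obtain ⟨u, hu⟩ := H.exists_lift (r : G)
      exact (hF1 k r u hu).2 (h1 r r.2 u hu)
  have hFconj : ∀ (g : G) (k l : centMod S R) (r s : R), (l : G) = g * k * g⁻¹ →
      (s : G) = g * r * g⁻¹ → F l (f s) = F k (f r) := by
    intro g k l r s hl hs
    obtain ⟨u, hu⟩ := H.exists_lift (r : G)
    have hv := hu.conj H.normal_left g
    rw [← hs] at hv
    have h1 := hF l s _ hv
    rw [hl, map_mul, map_mul, map_inv] at h1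
    have h2 : unitRep ρ g * unitRep ρ k * (unitRep ρ g)⁻¹ *
        (unitRep ρ g * u * (unitRep ρ g)⁻¹) *
        (unitRep ρ g * unitRep ρ k * (unitRep ρ g)⁻¹)⁻¹ =
        unitRep ρ g * (unitRep ρ k * u * (unitRep ρ k)⁻¹) * (unitRep ρ g)⁻¹ := by group
    rw [h2, hF k r u hu, ← mul_assoc, ← scalarUnit_comm, mul_assoc, mul_assoc,
      ← mul_assoc (unitRep ρ g)] at h1
    exact (scalarUnit_injective (mul_right_cancel h1)).symm
  have hsurj : ∀ T : Subgroup G, T.Normal → T ≤ centMod S R → ¬ T ≤ liftKer ρ S R →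
      ∀ l, ∃ t : centMod S R, (t : G) ∈ T ∧ F t = l := by
    intro T hT hTK hTV l
    -- The annihilator of `T` in `R` is normal and proper in `R`, hence equal to `S`. So `T`
    -- separates the points of `R / S` and maps onto the whole dual.
    let A : Subgroup G :=
      { carrier := {r | ∃ hr : r ∈ R, ∀ t : centMod S R, (t : G) ∈ T → F t (f ⟨r, hr⟩) = 1}
        one_mem' := ⟨R.one_mem, fun t _ => by
          rw [show (⟨1, R.one_mem⟩ : R) = 1 from rfl, map_one, map_one]⟩
        mul_mem' := by
          rintro a b ⟨ha, ha'⟩ ⟨hb, hb'⟩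
          refine ⟨R.mul_mem ha hb, fun t ht => ?_⟩
          rw [show (⟨a * b, R.mul_mem ha hb⟩ : R) = ⟨a, ha⟩ * ⟨b, hb⟩ from rfl, map_mul, map_mul,
            ha' t ht, hb' t ht, one_mul]
        inv_mem' := by
          rintro a ⟨ha, ha'⟩
          refine ⟨R.inv_mem ha, fun t ht => ?_⟩
          rw [show (⟨a⁻¹, R.inv_mem ha⟩ : R) = ⟨a, ha⟩⁻¹ from rfl, map_inv, map_inv, ha' t ht,
            inv_one] }
    have hA : A.Normal := ⟨by
      rintro a ⟨ha, ha'⟩ g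
      refine ⟨H.normal_right.conj_mem a ha g, fun t ht => ?_⟩
      have ht' : g⁻¹ * t * g ∈ T := by simpa using hT.conj_mem t ht g⁻¹
      rw [hFconj g ⟨g⁻¹ * t * g, hTK ht'⟩ t ⟨a, ha⟩ _ (by simp [mul_assoc]) rfl]
      exact ha' _ ht'⟩
    have hAS : A = S := by
      refine (h.eq_or_eq A hA (fun s hs => ⟨h.lt.le hs, fun t _ => ?_⟩)
        fun a ha => ha.1).resolve_right fun he => hTV fun t ht => ?_
      · rw [(hfS _).2 hs, map_one]
      · refine (hFker ⟨t, hTK ht⟩).1 ?_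
        ext1 x
        obtain ⟨r, rfl⟩ := hf x
        have hrA : (r : G) ∈ A := by rw [he]; exact r.2
        obtain ⟨hr, hr'⟩ := hrA
        exact hr' ⟨t, hTK ht⟩ ht
    have := surjective_of_separating hcomm (F.comp (T.subgroupOf (centMod S R)).subtype)
      fun x hx => by
        obtain ⟨r, rfl⟩ := hf x
        rw [hfS, ← hAS]
        exact ⟨r.2, fun t ht => hx ⟨t, ht⟩⟩
    obtain ⟨t, ht⟩ := this l
    exact ⟨t, t.2, ht⟩
  have hchief : IsChief (liftKer ρ S R) (centMod S R) := by
    refine ⟨inferInstance, inferInstance, lt_of_le_of_ne liftKer_le hne,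
      fun T hT h1 h2 => ?_⟩
    by_cases hTV : T ≤ liftKer ρ S R
    · exact Or.inl (le_antisymm hTV h1)
    · refine Or.inr (le_antisymm h2 fun k hk => ?_)
      obtain ⟨t, ht, hkt⟩ := hsurj T hT h2 hTV (F ⟨k, hk⟩)
      have h3 := h1 ((hFker (t⁻¹ * ⟨k, hk⟩)).1 (by rw [map_mul, map_inv, hkt, inv_mul_cancel]))
      simpa using T.mul_mem ht h3
  refine ⟨hchief, fun M' hM' hVM' hKM' => ?_⟩
  -- The quotient by `liftKer` embeds in a dual group through `F`, so this chief factor is abelian,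
  -- as `IsChief.exists_hom` requires.
  have hK : centMod S R ≤ centMod (liftKer ρ S R) (centMod S R) := fun a ha =>
    mem_centMod.2 fun b hb =>
      (hFker (⟨a, ha⟩ * ⟨b, hb⟩ * ⟨a, ha⟩⁻¹ * ⟨b, hb⟩⁻¹)).1 (by
        rw [← commutatorElement_def, map_commutatorElement, commutatorElement_eq_one_iff_mul_comm]
        exact MonoidHom.ext fun x => mul_comm (F ⟨a, ha⟩ x) (F ⟨b, hb⟩ x))
  obtain ⟨φ, hφ, hφV, hφg⟩ := hchief.exists_hom hK hM' hVM' hKM'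
  have hFsurj : Function.Surjective F := fun l => by
    obtain ⟨t, -, ht⟩ := hsurj _ inferInstance le_rfl hchief.lt.not_ge l
    exact ⟨t, ht⟩
  obtain ⟨e, he⟩ := exists_mulEquiv_of_surjective φ F hφ hFsurj fun k => by rw [hφV, hFker]
  refine ⟨e, fun g x => ?_⟩
  obtain ⟨k, rfl⟩ := hφ x
  let l : centMod S R := ⟨g * k * g⁻¹, (centMod_normal S R).conj_mem k k.2 g⟩
  rw [← hφg g k l rfl, he, he]
  ext1 y
  obtain ⟨r, rfl⟩ := hf y
  let s : R := ⟨g * r * g⁻¹, H.normal_right.conj_mem r r.2 g⟩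
  obtain ⟨r', hr'⟩ : ∃ r' : R, (r' : G) = g⁻¹ * r * g :=
    ⟨⟨_, by simpa using H.normal_right.conj_mem r r.2 g⁻¹⟩, rfl⟩
  have h1 : f r = conjAction M g (f r') := hfg g r' r (by simp [hr', mul_assoc])
  rw [h1, dualAction_apply, ← h1]
  exact hFconj g k l r' r rfl (by simp [hr', mul_assoc])

end Dual

/-! ### A complement to the fixed central subgroup under coprime action -/

section Coprime

variable {L : Type*} [CommGroup L]

/-- The elements of exponent `p` whose norm under `Γ` is trivial. -/
def normOneTorsion (Γ : Subgroup (MulAut L)) [Fintype Γ] (p : ℕ) : Subgroup L where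
  carrier := {u | u ^ p = 1 ∧ ∏ a : Γ, (a : MulAut L) u = 1}
  one_mem' := by simp
  mul_mem' := by
    rintro u v ⟨hu, hu'⟩ ⟨hv, hv'⟩
    exact ⟨by rw [mul_pow, hu, hv, one_mul], by
      simp only [map_mul, Finset.prod_mul_distrib, hu', hv', one_mul]⟩
  inv_mem' := by
    rintro u ⟨hu, hu'⟩
    exact ⟨by rw [inv_pow, hu, inv_one], by
      simp only [map_inv, Finset.prod_inv_distrib, hu', inv_one]⟩

theorem map_mem_normOneTorsion {Γ : Subgroup (MulAut L)} [Fintype Γ] {p : ℕ} {u : L}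
    (hu : u ∈ normOneTorsion Γ p) {b : MulAut L} (hb : ∀ a ∈ Γ, b⁻¹ * a * b ∈ Γ)
    (hb' : ∀ a ∈ Γ, b * a * b⁻¹ ∈ Γ) : b u ∈ normOneTorsion Γ p := by
  refine ⟨by rw [← map_pow, hu.1, map_one], ?_⟩
  let e : Γ ≃ Γ :=
    { toFun := fun a => ⟨b⁻¹ * a * b, hb a a.2⟩
      invFun := fun a => ⟨b * a * b⁻¹, hb' a a.2⟩
      left_inv := fun a => Subtype.ext (by simp [mul_assoc])
      right_inv := fun a => Subtype.ext (by simp [mul_assoc]) }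
  have h1 : ∀ a : Γ, (a : MulAut L) (b u) = b ((e a : MulAut L) u) := fun a => by
    change _ = b ((b⁻¹ * (a : MulAut L) * b) u)
    simp only [MulAut.mul_apply, MulAut.apply_inv_self]
  simp only [h1]
  rw [← map_prod, Equiv.prod_comp e fun a : Γ => (a : MulAut L) u, hu.2, map_one]

variable {Γ : Subgroup (MulAut L)} [Fintype Γ] {p : ℕ} {Z : Subgroup L}

/-- The norm of a fixed element is its power by $|\Gamma|$, which is prime to `p`. -/
theorem normOneTorsion_inf (hcop : (Fintype.card Γ).Coprime p)
    (hZ : ∀ a ∈ Γ, ∀ z ∈ Z, a z = z) {u : L} (hu : u ∈ normOneTorsion Γ p) (huZ : u ∈ Z) :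
    u = 1 := by
  have h1 : u ^ Fintype.card Γ = 1 := by
    have := hu.2
    rwa [Finset.prod_congr rfl fun (a : Γ) _ => hZ a a.2 u huZ, Finset.prod_const,
      Finset.card_univ] at this
  have h2 := orderOf_dvd_of_pow_eq_one h1
  have h3 := orderOf_dvd_of_pow_eq_one hu.1
  exact orderOf_eq_one_iff.1 (Nat.eq_one_of_dvd_coprimes hcop h2 h3)

theorem exists_mul_normOneTorsion (hcop : (Fintype.card Γ).Coprime p)
    (hZ : ∀ a ∈ Γ, ∀ z ∈ Z, a z = z) (hdiv : ∀ z ∈ Z, ∃ w ∈ Z, w ^ p = z)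
    (hpow : ∀ u : L, u ^ p ∈ Z) (hfix : ∀ u : L, (∀ a ∈ Γ, a u * u⁻¹ ∈ Z) → u ∈ Z) (u : L) :
    ∃ z ∈ Z, z * u ∈ normOneTorsion Γ p := by
  -- Dividing `u` by a `p`-th root in `Z` of its `p`-th power gives `v` with `v ^ p = 1`. Its norm
  -- `ν` is fixed by `Γ`, so it lies in `Z`.
  obtain ⟨w, hw, hwp⟩ := hdiv _ (hpow u)
  let v := w⁻¹ * u
  have hvp : v ^ p = 1 := by rw [mul_pow, inv_pow, hwp, inv_mul_cancel]
  let ν := ∏ a : Γ, (a : MulAut L) v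
  have hν : ν ∈ Z := hfix ν fun a ha => by
    have : a ν = ν := by
      simp only [ν, map_prod]
      exact Fintype.prod_equiv (Equiv.mulLeft (⟨a, ha⟩ : Γ)) _ _ fun b => rfl
    rw [this, mul_inv_cancel]
    exact Z.one_mem
  have hνp : ν ^ p = 1 := by
    simp only [ν]
    rw [← Finset.prod_pow]
    simp only [← map_pow, hvp, map_one, Finset.prod_const_one]
  obtain ⟨x, hx, hxν⟩ : ∃ x ∈ Z, x ^ Fintype.card Γ = ν⁻¹ ∧ x ^ p = 1 := by
    -- The Bézout coefficient inverts $|\Gamma|$ modulo `p`, so the norm of this element cancels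
    -- `ν`.
    refine ⟨ν ^ (-(Nat.gcdA (Fintype.card Γ) p)), Z.zpow_mem hν _, ?_, ?_⟩
    · have h := Nat.gcd_eq_gcd_ab (Fintype.card Γ) p
      rw [hcop] at h
      have h2 : -(Nat.gcdA (Fintype.card Γ) p) * (Fintype.card Γ : ℤ) =
          -1 + p * Nat.gcdB (Fintype.card Γ) p := by push_cast at h; linarith
      rw [← zpow_natCast, ← zpow_mul, h2, zpow_add, zpow_mul, zpow_natCast, hνp, one_zpow, mul_one,
        zpow_neg_one]
    · rw [← zpow_natCast, ← zpow_mul, mul_comm, zpow_mul, zpow_natCast, hνp, one_zpow]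
  refine ⟨x * w⁻¹, Z.mul_mem hx (Z.inv_mem hw), ?_⟩
  rw [mul_assoc]
  refine ⟨by rw [mul_pow, hxν.2, one_mul, hvp], ?_⟩
  simp only [map_mul, Finset.prod_mul_distrib]
  rw [Finset.prod_congr rfl fun (a : Γ) _ => hZ a a.2 x hx, Finset.prod_const, Finset.card_univ,
    hxν.1]
  have : ∏ a : Γ, (a : MulAut L) w⁻¹ * (a : MulAut L) u = ν := by
    simp only [ν, v, map_mul]
  rw [← Finset.prod_mul_distrib, this, inv_mul_cancel]

end Coprime

/-! ### `p`-groups acting on chief factors of `p`-power order -/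

section PGroupAction

variable {G : Type*} [Group G]

theorem le_centMod_comm {S Q R : Subgroup G} [S.Normal] :
    R ≤ centMod S Q ↔ Q ≤ centMod S R := by
  have key : ∀ {A B : Subgroup G}, A ≤ centMod S B → B ≤ centMod S A := by
    intro A B h b hb
    rw [mem_centMod]
    intro a ha
    have := S.inv_mem (mem_centMod.1 (h ha) b hb)
    simpa [mul_assoc] using this
  exact ⟨key, key⟩

theorem IsChief.inf_centMod {S Q R : Subgroup G} [S.Normal] (h : IsChief S R) (hQ : Q.Normal)
    (hQR : ¬ Q ≤ centMod S R) : R ⊓ centMod S Q = S := by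
  have := h.normal_right
  refine (h.eq_or_eq _ inferInstance (le_inf h.lt.le fun s hs => ?_) inf_le_left).resolve_right
    fun he => hQR (le_centMod_comm.1 (inf_eq_left.1 he))
  rw [mem_centMod]
  intro q _
  have := S.mul_mem hs (h.normal_left.conj_mem _ (S.inv_mem hs) q)
  simpa [mul_assoc] using this

/-- A normal subgroup inducing a `p`-group of automorphisms on a chief factor of `p`-power order
centralizes it. -/
theorem IsChief.le_centMod_of_pGroup [Finite G] {p a k : ℕ} (hp : p.Prime) {S Q R : Subgroup G}
    [S.Normal] (h : IsChief S R) (ha : S.relIndex R = p ^ a) (hQ : Q.Normal)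
    (hk : (centMod S R).relIndex Q = p ^ k) : Q ≤ centMod S R := by
  by_contra hQR
  have hA := h.inf_centMod hQ hQR
  have := h.normal_right
  have := Fact.mk hp
  have hXn : (R.map (QuotientGroup.mk' S)).Normal :=
    Subgroup.Normal.map inferInstance _ (QuotientGroup.mk'_surjective _)
  let X := R.map (QuotientGroup.mk' S)
  let φ : G →* MulAut X := (MulAut.conjNormal (H := X)).comp (QuotientGroup.mk' S)
  have hφ : ∀ (g r : G) (hr : r ∈ R),
      φ g ⟨QuotientGroup.mk' S r, Subgroup.mem_map_of_mem _ hr⟩ =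
        ⟨QuotientGroup.mk' S r, Subgroup.mem_map_of_mem _ hr⟩ ↔ g * r * g⁻¹ * r⁻¹ ∈ S := by
    intro g r hr
    rw [Subtype.ext_iff, ← QuotientGroup.eq_one_iff]
    simp [φ, mul_inv_eq_one]
  have hker : φ.ker = centMod S R := by
    ext g
    rw [MonoidHom.mem_ker, mem_centMod]
    constructor
    · exact fun hg r hr => (hφ g r hr).1 (by rw [hg]; rfl)
    · intro hg
      ext1 ⟨x, hx⟩
      obtain ⟨r, hr, rfl⟩ := hx
      exact (hφ g r hr).2 (hg r hr)
  have hcard : Nat.card (Q.map φ) = p ^ k := by rw [← Subgroup.relIndex_ker, hker, hk]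
  have hpg : IsPGroup p (Q.map φ) := IsPGroup.of_card hcard
  have hpX : p ∣ Nat.card X := by
    rw [card_map_mk', ha]
    refine dvd_pow_self p fun h0 => ?_
    rw [h0, pow_zero, Subgroup.relIndex_eq_one] at ha
    exact h.lt.not_ge ha
  have h1 : (1 : X) ∈ MulAction.fixedPoints (Q.map φ) X := fun g => map_one (g : MulAut X)
  -- A `p`-group acting on a nontrivial `p`-group fixes a nontrivial element, while the fixed points
  -- `R ⊓ centMod S Q` reduce to `S`.
  obtain ⟨⟨x, hx⟩, hxfix, hx1⟩ :=
    hpg.exists_fixed_point_of_prime_dvd_card_of_fixed_point X hpX h1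
  obtain ⟨r, hr, rfl⟩ := hx
  refine hx1 (Subtype.ext ?_)
  have hrA : r ∈ R ⊓ centMod S Q := by
    refine ⟨hr, mem_centMod.2 fun q hq => ?_⟩
    have := (hφ q r hr).1 (hxfix ⟨φ q, Subgroup.mem_map_of_mem _ hq⟩)
    have := S.inv_mem this
    simpa [mul_assoc] using this
  rw [hA] at hrA
  exact ((QuotientGroup.eq_one_iff r).2 hrA).symm

end PGroupAction

/-! ### The case where the centralizer commutes with all lifts -/

section Degenerate

variable {G V : Type*} [Group G] [AddCommGroup V] [Module ℂ V] [Finite G] [FiniteDimensional ℂ V]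
  {ρ : Representation ℂ G V} {S R : Subgroup G}

/-- The group of all lifts of elements of `R`. -/
def liftGroup (ρ : Representation ℂ G V) {S : Subgroup G} (hS : S.Normal) (R : Subgroup G) :
    Subgroup (Module.End ℂ V)ˣ where
  carrier := {u | ∃ r ∈ R, IsLift ρ S r u}
  one_mem' := ⟨1, R.one_mem, by simpa using isLift_scalarUnit (ρ := ρ) (S := S) 1⟩
  mul_mem' := by
    rintro u v ⟨r, hr, hu⟩ ⟨s, hs, hv⟩
    exact ⟨r * s, R.mul_mem hr hs, hu.mul hv⟩
  inv_mem' := by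
    rintro u ⟨r, hr, hu⟩
    exact ⟨r⁻¹, R.inv_mem hr, hu.inv hS⟩

/-- The action of `G` on the group of lifts by conjugation. -/
def liftAction (ρ : Representation ℂ G V) {S R : Subgroup G} (hS : S.Normal) (hR : R.Normal) :
    G →* MulAut (liftGroup ρ hS R) where
  toFun g :=
    { toFun := fun u => ⟨unitRep ρ g * u * (unitRep ρ g)⁻¹, by
        obtain ⟨r, hr, hu⟩ := u.2
        exact ⟨_, hR.conj_mem r hr g, hu.conj hS g⟩⟩
      invFun := fun u => ⟨(unitRep ρ g)⁻¹ * u * unitRep ρ g, by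
        obtain ⟨r, hr, hu⟩ := u.2
        exact ⟨_, by simpa using hR.conj_mem r hr g⁻¹, by simpa using hu.conj hS g⁻¹⟩⟩
      left_inv := fun u => Subtype.ext (by simp [mul_assoc])
      right_inv := fun u => Subtype.ext (by simp [mul_assoc])
      map_mul' := fun u v => Subtype.ext (by simp [mul_assoc]) }
  map_one' := by ext1 u; exact Subtype.ext (by simp)
  map_mul' g h := by ext1 u; exact Subtype.ext (by simp [mul_assoc])

variable [S.Normal] [Nontrivial V]

/-- If all lifts commute with the centralizer of the chief factor `R / S`, then there is a
contradiction with the irreducibility of `ρ`. -/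
theorem IsVanishing.false_of_centralizing (H : IsVanishing ρ S R)
    (hirr : ∀ z ∈ commutant ρ ⊤, ∃ c : ℂ, z = c • 1) {p k : ℕ} (hp : p.Prime)
    (hG : IsPSolvable p G) (h : IsChief S R) (hk : S.relIndex R = p ^ k)
    (hK : liftKer ρ S R = centMod S R) : False := by
  classical
  have hR := H.normal_right
  have hS := H.normal_left
  have hab : R ≤ centMod S R := h.le_centMod hp hk
  have hcent : ∀ t ∈ centMod S R, ∀ u ∈ liftGroup ρ hS R, unitRep ρ t * u = u * unitRep ρ t := by
    rintro t ht u ⟨r, hr, hu⟩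
    exact (hK ▸ ht : t ∈ liftKer ρ S R).2 r hr u hu
  -- a scalar lift lies over `S`
  have hscal : ∀ (c : ℂˣ) (r : G), r ∈ R → IsLift ρ S r (scalarUnit V c) → r ∈ S := by
    intro c r hr hu
    simpa using H.inv_mul_mem R.one_mem hr (isLift_scalarUnit c) hu
  -- it suffices to show that all lifts are scalar
  suffices hall : ∀ u ∈ liftGroup ρ hS R, ∃ c, u = scalarUnit V c by
    refine h.lt.not_ge fun r hr => ?_
    obtain ⟨u, hu⟩ := H.exists_lift r
    obtain ⟨c, rfl⟩ := hall u ⟨r, hr, hu⟩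
    exact hscal c r hr hu
  by_cases htop : centMod S R = ⊤
  · intro u hu
    obtain ⟨c, hc⟩ := hirr u (mem_commutant.2 fun g _ =>
      congrArg Units.val (hcent g (htop ▸ Subgroup.mem_top g) u hu))
    have hc0 : c ≠ 0 := by
      rintro rfl
      rw [zero_smul] at hc
      exact u.ne_zero hc
    exact ⟨Units.mk0 c hc0, Units.ext (by rw [hc, coe_scalarUnit]; rfl)⟩
  -- A chief factor above the centralizer acts nontrivially on `R / S`, so its order is prime to
  -- `p`: this is the source of the coprime action.
  obtain ⟨Q, hQ⟩ := exists_isChief_above (inferInstance : (centMod S R).Normal) htop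
  have hQn := hQ.normal_right
  have hQR : ¬ Q ≤ centMod S R := hQ.lt.not_ge
  have hpQ : ¬ p ∣ (centMod S R).relIndex Q := by
    rcases hQ.relIndex_eq_pow_or hp hG with ⟨m, hm⟩ | hm
    · exact absurd (h.le_centMod_of_pGroup hp hk hQn hm) hQR
    · exact hm
  let L := liftGroup ρ hS R
  -- A lift `v` of `s` is `ρ s` times an element of the span of `S`, and `u` commutes with both
  -- factors.
  let _ : CommGroup L := { (inferInstance : Group L) with
    mul_comm := by
      rintro ⟨u, hu⟩ ⟨v, hv⟩
      obtain ⟨r, hr, hu'⟩ := hu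
      obtain ⟨s, hs, hv'⟩ := hv
      refine Subtype.ext (Units.ext ?_)
      change (u : Module.End ℂ V) * v = v * u
      have h1 : ρ s * (u : Module.End ℂ V) = u * ρ s :=
        congrArg Units.val (hcent s (hab hs) u ⟨r, hr, hu'⟩)
      have h2 : (v : Module.End ℂ V) = ρ s * (ρ s⁻¹ * v) := by
        rw [← mul_assoc, ← map_mul]; simp
      have h3 := commute_of_mem_spanAlg hv'.2 hu'.1
      generalize ρ s⁻¹ * (v : Module.End ℂ V) = a at h2 h3
      rw [h2, ← mul_assoc, ← h1, mul_assoc, ← h3, mul_assoc] }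
  let α : G →* MulAut L := liftAction ρ hS hR
  have hα : ∀ g (u : L), (α g u : (Module.End ℂ V)ˣ) = unitRep ρ g * u * (unitRep ρ g)⁻¹ :=
    fun _ _ => rfl
  let Γ : Subgroup (MulAut L) := Q.map α
  have hαK : centMod S R ≤ α.ker := fun t ht => by
    rw [MonoidHom.mem_ker]
    ext1 u
    exact Subtype.ext (by rw [hα, hcent t ht u u.2, mul_inv_cancel_right]; rfl)
  have hΓcard : Nat.card Γ ∣ (centMod S R).relIndex Q := by
    rw [← Subgroup.relIndex_ker]
    exact Subgroup.relIndex_dvd_of_le_left _ hαK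
  have : Finite Γ := by
    have : Finite (Q.map α : Set (MulAut L)) := by
      rw [Subgroup.coe_map]; infer_instance
    exact this
  have := Fintype.ofFinite Γ
  have hcop : (Fintype.card Γ).Coprime p := by
    rw [Fintype.card_eq_nat_card, Nat.coprime_comm, hp.coprime_iff_not_dvd]
    exact fun hd => hpQ (hd.trans hΓcard)
  let Z : Subgroup L := (scalarUnit V).range.subgroupOf L
  have memZ : ∀ u : L, u ∈ Z ↔ ∃ c, scalarUnit V c = u := fun u => by
    simp [Z, Subgroup.mem_subgroupOf]
  have hsL : ∀ c, scalarUnit V c ∈ L := fun c => ⟨1, R.one_mem, isLift_scalarUnit c⟩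
  have hmemS : ∀ (u : L) (r : G), r ∈ S → IsLift ρ S r (u : (Module.End ℂ V)ˣ) → u ∈ Z :=
    fun u r hr hu => by
      obtain ⟨c, hc⟩ := hu.exists_scalar_of_one hS H.homogeneous hr
      exact (memZ u).2 ⟨c, hc.symm⟩
  have hZ : ∀ a ∈ Γ, ∀ z ∈ Z, a z = z := by
    rintro a ⟨q, hq, rfl⟩ z hz
    obtain ⟨c, hc⟩ := (memZ z).1 hz
    exact Subtype.ext (by rw [hα, ← hc, ← scalarUnit_comm, mul_inv_cancel_right])
  have hdiv : ∀ z ∈ Z, ∃ w ∈ Z, w ^ p = z := by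
    intro z hz
    obtain ⟨c, hc⟩ := (memZ z).1 hz
    obtain ⟨d, hd⟩ := IsAlgClosed.exists_pow_nat_eq (c : ℂ) hp.pos
    have hd0 : d ≠ 0 := by
      rintro rfl
      rw [zero_pow hp.ne_zero] at hd
      exact c.ne_zero hd.symm
    refine ⟨⟨scalarUnit V (Units.mk0 d hd0), hsL _⟩, (memZ _).2 ⟨_, rfl⟩, Subtype.ext ?_⟩
    rw [← hc, Subgroup.coe_pow, ← map_pow]
    congr 1
    exact Units.ext hd
  have hpow : ∀ u : L, u ^ p ∈ Z := by
    intro u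
    obtain ⟨r, hr, hu⟩ := u.2
    have hup : ∀ n : ℕ, IsLift ρ S (r ^ n) ((u : (Module.End ℂ V)ˣ) ^ n) := fun n => by
      induction n with
      | zero => simpa using isLift_scalarUnit (ρ := ρ) (S := S) 1
      | succ n ih => rw [pow_succ, pow_succ]; exact ih.mul hu
    exact hmemS _ _ (h.pow_mem hp hk hr) (hup p)
  -- If `Q` moves `u` only by scalars, then `Q` centralizes `r` modulo `S`, which forces `r ∈ S` and
  -- makes `u` scalar.
  have hfix : ∀ u : L, (∀ a ∈ Γ, a u * u⁻¹ ∈ Z) → u ∈ Z := by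
    intro u hu
    obtain ⟨r, hr, hur⟩ := u.2
    refine hmemS u r ?_ hur
    rw [← h.inf_centMod hQn hQR]
    refine ⟨hr, mem_centMod.2 fun q hq => ?_⟩
    obtain ⟨c, hc⟩ := (memZ _).1 (hu (α q) (Subgroup.mem_map_of_mem _ hq))
    have h1 : unitRep ρ q * u * (unitRep ρ q)⁻¹ = scalarUnit V c * u := by
      rw [hc, ← hα, Subgroup.coe_mul, Subgroup.coe_inv, inv_mul_cancel_right]
    have h2 := hur.conj hS q
    rw [h1] at h2
    have h3 : IsLift ρ S r (scalarUnit V c * u) := by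
      simpa using (isLift_scalarUnit (ρ := ρ) (S := S) c).mul hur
    have h4 := hS.conj_mem _ (H.inv_mul_mem (hR.conj_mem r hr q) hr h2 h3) r
    have e : r * ((q * r * q⁻¹)⁻¹ * r) * r⁻¹ = r * q * r⁻¹ * q⁻¹ := by group
    rwa [e] at h4
  let P := normOneTorsion Γ p
  have hPZ : ∀ u ∈ P, u ∈ Z → u = 1 := fun u hu huZ => normOneTorsion_inf hcop hZ hu huZ
  have hPα : ∀ g, ∀ u ∈ P, α g u ∈ P := by
    intro g u hu
    refine map_mem_normOneTorsion hu ?_ ?_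
    · rintro a ⟨q, hq, rfl⟩
      rw [← map_inv, ← map_mul, ← map_mul]
      exact Subgroup.mem_map_of_mem _ (by simpa using hQn.conj_mem q hq g⁻¹)
    · rintro a ⟨q, hq, rfl⟩
      rw [← map_inv, ← map_mul, ← map_mul]
      exact Subgroup.mem_map_of_mem _ (hQn.conj_mem q hq g)
  have : Finite P := by
    -- Two elements of `P` over the same group element differ by a scalar, and `P` meets the scalars
    -- trivially.
    choose r hr hrl using fun u : P => (u : L).2
    refine Finite.of_injective r fun u v huv => ?_
    have h1 : IsLift ρ S 1 (((u : L) * (v : L)⁻¹ : L) : (Module.End ℂ V)ˣ) := by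
      have := (hrl u).mul ((hrl v).inv hS)
      rwa [huv, mul_inv_cancel] at this
    have := hPZ _ (P.mul_mem u.2 (P.inv_mem v.2)) (hmemS _ 1 S.one_mem h1)
    exact Subtype.ext (mul_inv_eq_one.1 this)
  have := Fintype.ofFinite P
  let val : P → Module.End ℂ V := fun w => ((w : L) : (Module.End ℂ V)ˣ)
  -- Only the identity of `P` lies over `S`, so the other summands have trace zero. As `P` is
  -- `G`-invariant, Schur makes `e` a nonzero scalar; then `w * e = e` forces every `w` in `P` to be
  -- 1.
  let e : Module.End ℂ V := ∑ w : P, val w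
  have htrace : LinearMap.trace ℂ V e = finrank ℂ V := by
    simp only [e, map_sum]
    rw [Finset.sum_eq_single 1]
    · exact LinearMap.trace_one ℂ V
    · intro w _ hw
      obtain ⟨r, hr, hwr⟩ := (w : L).2
      refine H.trace_eq_zero hr (fun hrS => hw ?_) hwr
      exact Subtype.ext (hPZ w w.2 (hmemS w r hrS hwr))
    · simp
  obtain ⟨c, hc⟩ : ∃ c : ℂ, e = c • 1 := by
    refine hirr e (mem_commutant.2 fun g _ => ?_)
    simp only [e, Finset.mul_sum, Finset.sum_mul]
    let σ : P → P := fun w => ⟨α g w, hPα g w w.2⟩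
    have hσ : Function.Injective σ := fun v w hvw =>
      Subtype.ext ((α g).injective (congrArg Subtype.val hvw))
    let σ' := Equiv.ofBijective σ (Finite.injective_iff_bijective.1 hσ)
    rw [← Equiv.sum_comp σ' fun w => val w * ρ g]
    refine Finset.sum_congr rfl fun w _ => ?_
    have h1 : ((σ w : L) : (Module.End ℂ V)ˣ) * unitRep ρ g = unitRep ρ g * (w : L) := by
      change (α g w : (Module.End ℂ V)ˣ) * unitRep ρ g = _
      rw [hα, inv_mul_cancel_right]
    exact (congrArg Units.val h1).symm
  have hc0 : c ≠ 0 := by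
    rintro rfl
    rw [hc, zero_smul, map_zero] at htrace
    exact finrank_pos.ne' (Nat.cast_eq_zero.1 htrace.symm)
  have hP1 : ∀ w : P, val w = 1 := by
    intro w
    have h1 : val w * e = e := by
      simp only [e, Finset.mul_sum]
      exact Fintype.sum_equiv (Equiv.mulLeft w) _ _ fun v => rfl
    rw [hc, mul_smul_comm, mul_one] at h1
    exact smul_right_injective _ hc0 h1
  intro u hu
  obtain ⟨z, hz, hzu⟩ := exists_mul_normOneTorsion hcop hZ hdiv hpow hfix ⟨u, hu⟩
  have h1 : z * (⟨u, hu⟩ : L) = 1 := Subtype.ext (Units.ext (hP1 ⟨_, hzu⟩))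
  have h2 : (⟨u, hu⟩ : L) ∈ Z := by
    rw [eq_inv_of_mul_eq_one_right h1]; exact Z.inv_mem hz
  obtain ⟨c, hc⟩ := (memZ _).1 h2
  exact ⟨c, hc.symm⟩

end Degenerate

/-! ### The condition on $\bar\chi\chi$ and the induction on normal subgroups -/

section Main

variable {G V : Type*} [Group G] [AddCommGroup V] [Module ℂ V] [FiniteDimensional ℂ V]
  {ρ : Representation ℂ G V} {U : Subgroup G}

theorem induced_one_eq_zero [Fintype G] {g : G} (h : ∀ x : G, x⁻¹ * g * x ∉ U) :
    induced U (fun _ => 1) g = 0 := by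
  simp [induced, h]

theorem induced_one_ne_zero [Fintype G] {g : G} (h : g ∈ U) :
    induced U (fun _ => 1) g ≠ 0 := by
  classical
  unfold induced
  refine mul_ne_zero (inv_ne_zero (by simp)) ?_
  simp only [dite_eq_ite]
  rw [Finset.sum_boole]
  refine Nat.cast_ne_zero.2 (Finset.card_pos.2 ⟨1, ?_⟩).ne'
  simpa using h

omit [FiniteDimensional ℂ V] in
theorem character_eq_zero [Fintype G]
    (hU : ∀ g : G, (starRingEnd ℂ) (ρ.character g) * ρ.character g = induced U (fun _ => 1) g)
    {g : G} (h : ∀ x : G, x⁻¹ * g * x ∉ U) : ρ.character g = 0 := by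
  have h1 := hU g
  rw [induced_one_eq_zero h] at h1
  exact (mul_eq_zero.1 h1).elim (fun h2 => (map_eq_zero _).1 h2) id

omit [FiniteDimensional ℂ V] in
theorem character_ne_zero [Fintype G]
    (hU : ∀ g : G, (starRingEnd ℂ) (ρ.character g) * ρ.character g = induced U (fun _ => 1) g)
    {g : G} (h : g ∈ U) : ρ.character g ≠ 0 := fun h0 =>
  induced_one_ne_zero h (by rw [← hU, h0, mul_zero])

/-- The average of $\bar\chi\chi$ over `N` is the dimension of the commutant. Averaging the induced
character instead counts, for each `x` in `G`, a conjugate copy of `U ⊓ N`. -/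
theorem card_mul_finrank_commutant [Fintype G] {N : Subgroup G} (hN : N.Normal)
    (hU : ∀ g : G, (starRingEnd ℂ) (ρ.character g) * ρ.character g = induced U (fun _ => 1) g) :
    U.relIndex N * finrank ℂ (commutant ρ N) = U.index := by
  classical
  have hcount : ∑ n : N, induced U (fun _ => 1) (n : G) =
      (Nat.card U : ℂ)⁻¹ * (Nat.card G * Nat.card (U ⊓ N : Subgroup G)) := by
    simp only [induced, dite_eq_ite]
    rw [← Finset.mul_sum, Finset.sum_comm]
    congr 1
    have : ∀ x : G, (∑ n : N, if x⁻¹ * (n : G) * x ∈ U then (1 : ℂ) else 0) =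
        Nat.card (U ⊓ N : Subgroup G) := by
      intro x
      rw [Finset.sum_boole, Nat.card_eq_fintype_card, Nat.cast_inj, ← Fintype.card_subtype]
      refine Fintype.card_congr
        { toFun := fun n => ⟨x⁻¹ * n.1 * x, n.2, by simpa using hN.conj_mem n.1 n.1.2 x⁻¹⟩
          invFun := fun m => ⟨⟨x * m.1 * x⁻¹, hN.conj_mem m.1 m.2.2 x⟩, by
            simpa [mul_assoc] using m.2.1⟩
          left_inv := fun n => by ext; simp [mul_assoc]
          right_inv := fun m => by ext; simp [mul_assoc] }
    rw [Finset.sum_congr rfl fun x _ => this x, Finset.sum_const, Finset.card_univ,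
      nsmul_eq_mul, Nat.card_eq_fintype_card (α := G)]
  have h1 : ∑ n : N, ρ.character n * ρ.character (n : G)⁻¹ =
      ∑ n : N, induced U (fun _ => 1) (n : G) :=
    Finset.sum_congr rfl fun n _ => by rw [character_inv, mul_comm, hU]
  have h2 := finrank_commutant (N := N) ρ
  rw [h1, hcount] at h2
  have e1 : Nat.card (U ⊓ N : Subgroup G) * U.relIndex N = Nat.card N := by
    rw [← Subgroup.relIndex_bot_left, ← Subgroup.inf_relIndex_right U N,
      Subgroup.relIndex_mul_relIndex _ _ _ bot_le inf_le_right, Subgroup.relIndex_bot_left]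
  have e2 := Subgroup.card_mul_index U
  have hU0 : (Nat.card U : ℂ) ≠ 0 := by simp
  have hI0 : (Nat.card (U ⊓ N : Subgroup G) : ℂ) ≠ 0 := Nat.cast_ne_zero.2 Nat.card_pos.ne'
  have hr0 : (U.relIndex N : ℂ) ≠ 0 := by
    intro h0
    rw [Nat.cast_eq_zero.1 h0, mul_zero] at e1
    exact Nat.card_pos.ne e1
  rw [← e1, ← e2] at h2
  push_cast at h2
  have : (U.relIndex N : ℂ) * finrank ℂ (commutant ρ N) = U.index := by
    rw [h2]
    field_simp
  exact_mod_cast this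

/-- Since $|U|\,|N:U\cap N|=|UN|$, the dimension of the commutant depends only on $UN$, and one
commutant contains the other. -/
theorem commutant_eq_of_sup_eq [Fintype G] {S R : Subgroup G} (hS : S.Normal) (hR : R.Normal)
    (hSR : S ≤ R)
    (hU : ∀ g : G, (starRingEnd ℂ) (ρ.character g) * ρ.character g = induced U (fun _ => 1) g)
    (h : U ⊔ R = U ⊔ S) : commutant ρ R = commutant ρ S := by
  have hrel : U.relIndex R = U.relIndex S := by
    have key : ∀ N : Subgroup G, N.Normal →
        Nat.card U * U.relIndex N = Nat.card (U ⊔ N : Subgroup G) := by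
      intro N hN
      have e1 : Nat.card (U ⊓ N : Subgroup G) * U.relIndex N = Nat.card N := by
        rw [← Subgroup.relIndex_bot_left, ← Subgroup.inf_relIndex_right U N,
          Subgroup.relIndex_mul_relIndex _ _ _ bot_le inf_le_right, Subgroup.relIndex_bot_left]
      have e2 : Nat.card (U ⊓ N : Subgroup G) * N.relIndex U = Nat.card U := by
        rw [← Subgroup.relIndex_bot_left, ← Subgroup.inf_relIndex_left U N,
          Subgroup.relIndex_mul_relIndex _ _ _ bot_le inf_le_left, Subgroup.relIndex_bot_left]
      have e3 : Nat.card N * N.relIndex U = Nat.card (U ⊔ N : Subgroup G) := by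
        rw [← Subgroup.relIndex_bot_left, ← Subgroup.relIndex_sup_right (H := U),
          Subgroup.relIndex_mul_relIndex _ _ _ bot_le le_sup_right, Subgroup.relIndex_bot_left]
      rw [← e3, ← e1, ← e2]
      ring
    have h1 := key R hR
    rw [h, ← key S hS] at h1
    exact Nat.eq_of_mul_eq_mul_left Nat.card_pos h1
  have h1 := card_mul_finrank_commutant hR hU
  rw [hrel, ← card_mul_finrank_commutant hS hU] at h1
  have hpos : 0 < U.relIndex S := Nat.pos_of_ne_zero fun h0 => by
    have := card_mul_finrank_commutant hS hU
    rw [h0, zero_mul] at this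
    exact Subgroup.index_ne_zero_of_finite this.symm
  exact Subalgebra.eq_of_le_of_finrank_eq (commutant_anti hSR)
    (Nat.eq_of_mul_eq_mul_left hpos h1)

theorem isHomogeneous_of_isRegularIntersection [Fintype G] [Nontrivial V]
    (hirr : ∀ z ∈ commutant ρ ⊤, ∃ c : ℂ, z = c • 1)
    (hU : ∀ g : G, (starRingEnd ℂ) (ρ.character g) * ρ.character g = induced U (fun _ => 1) g)
    (hreg : IsRegularIntersection U) {N : Subgroup G} (hN : N.Normal) : IsHomogeneous ρ N := by
  obtain ⟨hps, m, M, hM, hUM, hiso⟩ := hreg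
  have hps' : ∀ i, ∀ p : ℕ, p.Prime → p ∣ (M i).index → IsPSolvable p G := fun i p hp hd =>
    hps p hp (hd.trans (Subgroup.index_dvd_of_le (hUM ▸ iInf_le M i)))
  have hinj : ∀ S R, IsChief S R → ∀ i j, S ≤ M i → ¬ R ≤ M i → S ≤ M j → ¬ R ≤ M j → i = j := by
    intro S R h i j hSi hRi hSj hRj
    by_contra hij
    have := h.normal_left
    obtain ⟨p, k, hp, -, hk⟩ := h.exists_prime (hM i) hSi hRi (hps' i)
    exact (hiso i j hij).1 (h.gIso (h.le_centMod hp hk) (hM i) hSi hRi (hM j) hSj hRj)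
  have hsup : ∀ N : Subgroup G, N.Normal → U ⊔ N = ⨅ (i) (_ : N ≤ M i), M i := fun N hN => by
    rw [hUM]; exact iInf_sup_eq M hM hinj N hN
  have hsup_eq : ∀ S R : Subgroup G, S.Normal → R.Normal → S ≤ R →
      (∀ i, S ≤ M i → R ≤ M i) → U ⊔ R = U ⊔ S := fun S R hS hR hSR h => by
    rw [hsup S hS, hsup R hR]
    exact iInf_congr fun i => iInf_congr_Prop ⟨fun h' => hSR.trans h', h i⟩ fun _ => rfl
  induction hc : Nat.card N using Nat.strong_induction_on generalizing N with
  | _ c ih =>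
  by_cases hb : N = ⊥
  · subst hb
    intro z hz _
    induction hz using spanAlg_induction with
    | hsmul n hn c => exact ⟨c, by rw [Subgroup.mem_bot.1 hn, map_one]⟩
    | hadd a b _ _ ha hb =>
      obtain ⟨c, rfl⟩ := ha (mem_commutant.2 fun n hn => by simp [Subgroup.mem_bot.1 hn])
      obtain ⟨d, rfl⟩ := hb (mem_commutant.2 fun n hn => by simp [Subgroup.mem_bot.1 hn])
      exact ⟨c + d, (add_smul c d _).symm⟩
  obtain ⟨S, h⟩ := exists_isChief_below hN hb
  have hSn := h.normal_left
  have hS : IsHomogeneous ρ S := ih _ (hc ▸ Set.Finite.card_lt_card (Set.toFinite _) h.lt) hSn rfl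
  by_cases hex : ∃ i, S ≤ M i ∧ ¬ N ≤ M i
  · obtain ⟨i, hSi, hNi⟩ := hex
    obtain ⟨p, k, hp, hpG, hk⟩ := h.exists_prime (hM i) hSi hNi (hps' i)
    have hab := h.le_centMod hp hk
    have hNM := h.inf_coatom hab (hM i) hSi hNi
    have H : IsVanishing ρ S N := by
      refine ⟨hSn, hN, h.lt.le, hS, fun r hr hrS => character_eq_zero hU fun x hx => hrS ?_⟩
      have h1 : x⁻¹ * r * x ∈ N ⊓ M i :=
        ⟨by simpa using hN.conj_mem r hr x⁻¹, (hUM ▸ iInf_le M i : U ≤ M i) hx⟩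
      rw [hNM] at h1
      simpa [mul_assoc] using hSn.conj_mem _ h1 x
    -- The pairing restricted to `N` is either trivial, which is refuted, or nondegenerate modulo
    -- `S`.
    by_cases hdeg : N ≤ liftKer ρ S N
    · exfalso
      by_cases hK : liftKer ρ S N = centMod S N
      · exact H.false_of_centralizing hirr hp hpG h hk hK
      obtain ⟨hchief, hdual⟩ := H.dual_chief h hab (hM i) hSi hNi hK
      by_cases hex : ∃ j, liftKer ρ S N ≤ M j ∧ ¬ centMod S N ≤ M j
      · obtain ⟨j, hVj, hKj⟩ := hex
        have hji : j ≠ i := by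
          rintro rfl
          exact hNi (hdeg.trans hVj)
        exact (hiso j i hji).2 (hdual (M j) (hM j) hVj hKj)
      · push Not at hex
        have hsupK := hsup_eq _ _ inferInstance inferInstance hchief.lt.le hex
        refine hchief.lt.not_ge fun x hx => ?_
        -- Modulo `liftKer`, an element of the centralizer is represented by an element `u` of `U`;
        -- outside `liftKer` the character would vanish at `u`.
        have hx' : x ∈ U ⊔ liftKer ρ S N := hsupK ▸ Subgroup.mem_sup_right hx
        obtain ⟨u, hu, v, hv, rfl⟩ := Subgroup.mem_sup_of_normal_right.1 hx'
        refine mul_mem ?_ hv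
        by_contra huV
        refine character_ne_zero hU hu (H.character_eq_zero ?_ huV)
        exact (mul_mem_cancel_right (liftKer_le hv)).1 hx
    · refine H.homogeneous_of_nondegenerate hab fun r hr hcomm => ?_
      -- The radical of the pairing on `N`: normal between `S` and `N`, and different from `N` by
      -- `hdeg`.
      let A : Subgroup G :=
        { carrier := {r | r ∈ N ∧ ∀ u, IsLift ρ S r u → ∀ t ∈ N,
            unitRep ρ t * u = u * unitRep ρ t}
          one_mem' := ⟨N.one_mem, fun u hu t _ => by
            obtain ⟨c, rfl⟩ := hu.exists_scalar_of_one hSn hS S.one_mem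
            exact (scalarUnit_comm c _).symm⟩
          mul_mem' := by
            rintro a b ⟨ha, ha'⟩ ⟨hb, hb'⟩
            refine ⟨N.mul_mem ha hb, fun u hu t ht => ?_⟩
            obtain ⟨v, hv⟩ := H.exists_lift a
            have h1 := (hv.inv hSn).mul hu
            rw [inv_mul_cancel_left] at h1
            have h2 := hb' _ h1 t ht
            have h3 := ha' v hv t ht
            calc unitRep ρ t * u = unitRep ρ t * v * (v⁻¹ * u) := by group
              _ = v * (unitRep ρ t * (v⁻¹ * u)) := by rw [h3, mul_assoc]
              _ = _ := by rw [h2]; group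
          inv_mem' := by
            rintro a ⟨ha, ha'⟩
            refine ⟨N.inv_mem ha, fun u hu t ht => ?_⟩
            have h1 := hu.inv hSn
            rw [inv_inv] at h1
            have h2 := ha' _ h1 t ht
            rw [mul_inv_eq_iff_eq_mul, mul_assoc, eq_inv_mul_iff_mul_eq] at h2
            exact h2.symm }
      have hA : A.Normal := ⟨by
        rintro a ⟨ha, ha'⟩ g
        refine ⟨hN.conj_mem a ha g, fun u hu t ht => ?_⟩
        have h1 := hu.conj_inv (g := g)
        have e : g⁻¹ * (g * a * g⁻¹) * g = a := by group
        rw [e] at h1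
        have h2 := ha' _ h1 (g⁻¹ * t * g) (by simpa using hN.conj_mem t ht g⁻¹)
        rw [map_mul, map_mul, map_inv] at h2
        calc unitRep ρ t * u = unitRep ρ g * ((unitRep ρ g)⁻¹ * unitRep ρ t * unitRep ρ g *
              ((unitRep ρ g)⁻¹ * u * unitRep ρ g)) * (unitRep ρ g)⁻¹ := by group
          _ = _ := by rw [h2]; group⟩
      have hAS : A = S := by
        refine (h.eq_or_eq A hA (fun s hs => ⟨h.lt.le hs, fun u hu t _ => ?_⟩)
          fun a ha => ha.1).resolve_right fun he => hdeg fun t ht => ⟨hab ht, fun r hr u hu => ?_⟩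
        · obtain ⟨c, rfl⟩ := hu.exists_scalar_of_one hSn hS hs
          exact (scalarUnit_comm c _).symm
        · exact (he ▸ hr : r ∈ A).2 u hu t ht
      exact hAS ▸ (⟨hr, hcomm⟩ : r ∈ A)
  · push Not at hex
    exact hS.of_commutant_eq h.lt.le
      (commutant_eq_of_sup_eq hSn hN h.lt.le hU (hsup_eq S N hSn hN h.lt.le hex))

theorem exists_eq_smul_of_isIrreducible (hρ : ρ.IsIrreducible) (z : Module.End ℂ V)
    (hz : z ∈ commutant ρ ⊤) : ∃ c : ℂ, z = c • 1 := by
  let f : IntertwiningMap ρ ρ := z.intertwiningMap_of_isIntertwiningMap ρ ρ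
    fun g v => (LinearMap.congr_fun (mem_commutant.1 hz g (Subgroup.mem_top g)) v).symm
  obtain ⟨c, hc⟩ := (IsIrreducible.algebraMap_intertwiningMap_bijective_of_isAlgClosed
    (ρ := ρ)).2 f
  refine ⟨c, LinearMap.ext fun v => ?_⟩
  have : f v = (algebraMap ℂ (IntertwiningMap ρ ρ) c) v := by rw [hc]
  exact this

end Main

end WildeChar

theorem theoremE {G : Type*} [Group G] [Fintype G] (χ : G → ℂ) (U : Subgroup G)
    (hχ : WildeChar.IsIrr χ)
    (hU : ∀ g : G, (starRingEnd ℂ) (χ g) * χ g = WildeChar.induced U (fun _ => 1) g)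
    (hreg : WildeChar.IsRegularIntersection U) :
    WildeChar.IsQuasiPrimitive χ := by
  obtain ⟨n, ρ, hρ, rfl⟩ := hχ
  refine ⟨⟨n, ρ, hρ, rfl⟩, fun N hN => ?_⟩
  have : Nontrivial (Fin n → ℂ) := by
    by_contra hn
    rw [not_nontrivial_iff_subsingleton] at hn
    refine bot_ne_top (α := Subrepresentation ρ) (Subrepresentation.toSubmodule_injective ?_)
    exact Subsingleton.elim _ _
  exact (WildeChar.isHomogeneous_of_isRegularIntersection
    (WildeChar.exists_eq_smul_of_isIrreducible hρ) hU hreg hN).exists_isIrr
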